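/- Let $\lambda,\mu\in(0,\infty)$. For integers $n,m\ge 0$ and $p\in[0,1]$, the binomial random intersection graph $G(n,m,p)$ is the random graph on $\{1,\dots,n\}$ in which distinct nodes $i,j$ are adjacent if and only if $\sum_{k=1}^m B(i,k)B(j,k)\ge 1$, where $B(i,k)$, $1\le i\le n$, $1\le k\le m$, are independent $\{0,1\}$-valued random variables with mean $p$. For a graph $H$ let $N_{K_3}(H)$ and $N_{S_2}(H)$ be the numbers of subgraphs of $H$ (not necessarily induced) that are isomorphic to the triangle $K_3$ and to the 2-star $S_2$ (one centre, two leaves), respectively. When $N_{S_2}(H)>0$, the empirical transitivity coefficient of $H$ is $t(H)=3N_{K_3}(H)/N_{S_2}(H)$; the model transitivity coefficient of a random graph $H$ with $\mathbb{E}N_{S_2}(H)>0$ is $\tau(H)=3\,\mathbb{E}N_{K_3}(H)/\mathbb{E}N_{S_2}(H)$. Consider a sequence of random intersection graphs $G=G(n,m,p)$ with $(n,m,p)=(n_\nu,m_\nu,p_\nu)$ in the balanced sparse parameter regime, i.e. as $\nu\to\infty$, $$n\to\infty,\qquad m\sim\frac{\mu^2}{\lambda}\,n,\qquad p\sim\frac{\lambda}{\mu}\,n^{-1}.$$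 (i) For each $\nu$ let $V^{(n_0)}$ be a (possibly random) set of $n_0=n_{0,\nu}\le n$ nodes that is stochastically independent of $G$, let $G^{(n_0)}$ be the subgraph of $G$ induced by $V^{(n_0)}$, and suppose that $n^{2/3}/n_0\to 0$. Then $N_{S_2}(G^{(n_0)})>0$ with probability tending to $1$, and $$t(G^{(n_0)})=\frac{1}{1+\mu}+o_p(1),$$ i.e. $t(G^{(n_0)})\to\frac1{1+\mu}$ in probability. (ii) Consequently, $\mathbb{E}N_{S_2}(G)>0$ for all large $\nu$, and $t(G)=\tau(G)+o_p(1)$, i.e. $t(G)-\tau(G)\to 0$ in probability. -/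

import Mathlib

open Filter Topology MeasureTheory ProbabilityTheory Asymptotics

/-- The attribute matrix of a binomial random intersection graph: the entries `B i k`
(node `i`, attribute `k`) are independent `{0,1}`-valued random integers with mean `p`. -/
structure IsBinomialAttributeMatrix {Ω : Type*} [MeasurableSpace Ω] (P : Measure Ω)
    {n m : ℕ} (B : Fin n → Fin m → Ω → ℕ) (p : ℝ) : Prop where
  measurable : ∀ i k, Measurable (B i k)
  zero_or_one : ∀ i k ω, B i k ω = 0 ∨ B i k ω = 1
  indep : iIndepFun (fun q : Fin n × Fin m => B q.1 q.2) P
  mean : ∀ i k, ∫ ω, (B i k ω : ℝ) ∂P = p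

/-- The intersection graph of an attribute matrix: distinct nodes `i`, `j` are adjacent iff
they have a common attribute, i.e. `min (∑ k, B i k * B j k) 1 = 1`. -/
def intersectionGraph {n m : ℕ} (B : Fin n → Fin m → ℕ) : SimpleGraph (Fin n) where
  Adj i j := i ≠ j ∧ min (∑ k, B i k * B j k) 1 = 1
  symm := ⟨fun i j h => ⟨h.1.symm, by simpa only [mul_comm] using h.2⟩⟩
  loopless := ⟨fun _ h => h.1 rfl⟩

/-- The random graph obtained from a random attribute matrix. -/
def randomIntersectionGraph {Ω : Type*} {n m : ℕ} (B : Fin n → Fin m → Ω → ℕ) (ω : Ω) :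
    SimpleGraph (Fin n) :=
  intersectionGraph fun i k => B i k ω

/-- The number of triangles: subgraphs of `G` isomorphic to `K₃`. -/
noncomputable def numTriangles {V : Type*} [Fintype V] (G : SimpleGraph V) : ℕ :=
  G.copyCount (SimpleGraph.completeGraph (Fin 3))

/-- The number of 2-stars: (not necessarily induced) subgraphs of `G` isomorphic to the
star with one centre and two leaves. -/
noncomputable def numTwoStars {V : Type*} [Fintype V] (G : SimpleGraph V) : ℕ :=
  G.copyCount (SimpleGraph.starGraph (0 : Fin 3))

/-- The (empirical) transitivity coefficient `t(G)`; meaningful if `0 < numTwoStars G`. -/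
noncomputable def transitivity {V : Type*} [Fintype V] (G : SimpleGraph V) : ℝ :=
  3 * ((numTriangles G : ℝ) / (numTwoStars G : ℝ))

/-- The model transitivity coefficient `τ(G)` of a random graph `G`. -/
noncomputable def modelTransitivity {Ω : Type*} [MeasurableSpace Ω] (P : Measure Ω)
    {V : Type*} [Fintype V] (G : Ω → SimpleGraph V) : ℝ :=
  3 * ((∫ ω, (numTriangles (G ω) : ℝ) ∂P) / (∫ ω, (numTwoStars (G ω) : ℝ) ∂P))

/-- The balanced sparse parameter regime with mean degree `lam` and attribute intensity `mu`:
`n ≫ 1`, `m ∼ (mu² / lam) n`, `p ∼ (lam / mu) n⁻¹`. -/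
structure IsBalancedSparse (lam mu : ℝ) (n m : ℕ → ℕ) (p : ℕ → ℝ) : Prop where
  tendsto_n : Tendsto n atTop atTop
  equiv_m : (fun ν => (m ν : ℝ)) ~[atTop] fun ν => mu ^ 2 / lam * (n ν : ℝ)
  equiv_p : p ~[atTop] fun ν => lam / mu * (n ν : ℝ)⁻¹

/-- `X = o_p(1)`: the random variables `X ν`, each defined on its own probability space,
converge to zero in probability. -/
def IsLittleOpOne {Ω : ℕ → Type*} [∀ ν, MeasurableSpace (Ω ν)] (P : ∀ ν, Measure (Ω ν))
    (X : ∀ ν, Ω ν → ℝ) : Prop :=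
  ∀ ε : ℝ, 0 < ε → Tendsto (fun ν => P ν {ω | ε < |X ν ω|}) atTop (𝓝 0)

/-! ### Subgraph counts as sums over ordered triples of distinct nodes. -/

section Counting

variable {V W : Type*}

/-! This is the second-moment method applied to the two counts separately. Since `K₃` has 6
automorphisms and the 2-star has 2, the transitivity coefficient is the number of ordered triangles
divided by the number of ordered 2-stars. Both are sums of indicators over triples of distinct
nodes.

First moments: two edges at a common centre arise either from one attribute shared by all three
nodes (probability about `m p³`) or from two different attributes (about `m² p⁴`). A triangle
essentially needs one common attribute. As `n p → λ/μ` and `m p → μ`, multiplying by `n²` gives the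
limits `λ²/μ + λ²` for stars and `λ²/μ` for triangles, with quotient `1/(1+μ)`. Hence on a set of
`n₀` nodes both means are of order `r = n₀³/n²` (`le_measureReal_starEvent`,
`le_measureReal_triangleEvent` and the matching upper bounds).

Second moments: events on disjoint triples are independent, so only overlapping triples contribute
to the variance. Exploring the union of two overlapping stars along a forest, each newly reached
node costs a factor `q = p (8 + m p) = O(1/n)` (`measureReal_growing_le`). Summing over overlapping
pairs bounds the variance by `O(r)`, and Chebyshev at scale `r` leaves a failure probability
`O(1/r)`. This vanishes exactly because `n₀ ≫ n^(2/3)` makes `r → ∞`.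

The bounds are uniform over node sets of size `n₀`, so an independent random set may be treated as
fixed (`measureReal_le_of_indepFun`). For the whole graph, take `n₀ = n`; the same first moments
show that the model coefficient also tends to `1/(1+μ)`. -/

theorem exists_labelledCopyCount_eq_card_univ [Fintype V] [Fintype W] (G : SimpleGraph V)
    (H : SimpleGraph W) :
    ∃ _ : Fintype (H.Copy G), G.labelledCopyCount H = (Finset.univ : Finset (H.Copy G)).card := by
  classical
  exact ⟨inferInstance, rfl⟩

/-- Labelled copies are sorted by their image subgraph. Once an isomorphism `e` from `H` onto an
image is fixed, the labelled copies with that image are exactly the maps `e ∘ σ` with `σ` an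
automorphism of `H`. -/
theorem labelledCopyCount_eq_copyCount_mul [Fintype W] [Fintype V] (G : SimpleGraph V) (H : SimpleGraph W) :
    G.labelledCopyCount H = G.copyCount H * Nat.card (H ≃g H) := by
  classical
  have : Finite (H ≃g H) := Finite.of_injective (fun f => (f : W → W)) DFunLike.coe_injective
  have := Fintype.ofFinite (H ≃g H)
  rw [SimpleGraph.labelledCopyCount, SimpleGraph.copyCount, ← Finset.card_univ,
    Finset.card_eq_sum_card_fiberwise (f := SimpleGraph.Copy.toSubgraph)
      (t := Finset.univ.filter fun G' : G.Subgraph => Nonempty (H ≃g G'.coe))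
      (fun f _ => by simpa using ⟨f.isoToSubgraph⟩), Finset.sum_const_nat]
  intro G' hG'
  obtain ⟨e⟩ := (Finset.mem_filter.1 hG').2
  rw [Nat.card_eq_fintype_card, ← Finset.card_univ]
  symm
  refine Finset.card_bij (fun σ _ => G'.coeCopy.comp (SimpleGraph.Iso.toCopy (σ.trans e))) ?_ ?_ ?_
  · intro σ _
    simp only [Finset.mem_filter, Finset.mem_univ, true_and]
    have hsurj : Function.Surjective fun a => e (σ a) := (e.toEquiv.surjective.comp σ.surjective)
    ext x y
    · simp only [SimpleGraph.Copy.toSubgraph, SimpleGraph.Subgraph.map_verts]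
      constructor
      · rintro ⟨a, -, rfl⟩
        exact (e (σ a)).2
      · intro hx
        obtain ⟨a, ha⟩ := hsurj ⟨x, hx⟩
        exact ⟨a, trivial, congrArg Subtype.val ha⟩
    · simp only [SimpleGraph.Copy.toSubgraph, SimpleGraph.Subgraph.map_adj, Relation.Map]
      constructor
      · rintro ⟨a, b, hab, rfl, rfl⟩
        exact e.map_rel_iff.2 (σ.map_rel_iff.2 hab)
      · intro hxy
        obtain ⟨a, ha⟩ := hsurj ⟨x, G'.edge_vert hxy⟩
        obtain ⟨b, hb⟩ := hsurj ⟨y, G'.edge_vert hxy.symm⟩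
        refine ⟨a, b, ?_, congrArg Subtype.val ha, congrArg Subtype.val hb⟩
        simp only at ha hb
        have : G'.coe.Adj (e (σ a)) (e (σ b)) := by rw [ha, hb]; exact hxy
        exact σ.map_rel_iff.1 (e.map_rel_iff.1 this)
  · intro σ _ τ _ h
    ext a
    have h1 : ((e (σ a) : G'.verts) : V) = e (τ a) := DFunLike.congr_fun h a
    exact e.injective (Subtype.ext h1)
  · intro f hf
    obtain rfl := (Finset.mem_filter.1 hf).2
    refine ⟨f.isoToSubgraph.trans e.symm, Finset.mem_univ _, ?_⟩
    ext a
    change ((e (e.symm (f.isoToSubgraph a)) : f.toSubgraph.verts) : V) = f a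
    rw [e.apply_symm_apply]
    rfl

theorem natCard_aut_completeGraph :
    Nat.card (SimpleGraph.completeGraph (Fin 3) ≃g SimpleGraph.completeGraph (Fin 3)) = 6 := by
  have e : (SimpleGraph.completeGraph (Fin 3) ≃g SimpleGraph.completeGraph (Fin 3)) ≃
      {σ : Equiv.Perm (Fin 3) // ∀ a b, σ a ≠ σ b ↔ a ≠ b} :=
    { toFun := fun f => ⟨f.toEquiv, fun a b => f.map_rel_iff⟩
      invFun := fun σ => ⟨σ.1, fun {a b} => σ.2 a b⟩
      left_inv := fun _ => rfl
      right_inv := fun _ => rfl }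
  rw [Nat.card_congr e, Nat.card_eq_fintype_card]
  decide

theorem natCard_aut_starGraph :
    Nat.card (SimpleGraph.starGraph (0 : Fin 3) ≃g SimpleGraph.starGraph (0 : Fin 3)) = 2 := by
  have e : (SimpleGraph.starGraph (0 : Fin 3) ≃g SimpleGraph.starGraph (0 : Fin 3)) ≃
      {σ : Equiv.Perm (Fin 3) // ∀ a b, (SimpleGraph.starGraph (0 : Fin 3)).Adj (σ a) (σ b) ↔
        (SimpleGraph.starGraph (0 : Fin 3)).Adj a b} :=
    { toFun := fun f => ⟨f.toEquiv, fun a b => f.map_rel_iff⟩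
      invFun := fun σ => ⟨σ.1, fun {a b} => σ.2 a b⟩
      left_inv := fun _ => rfl
      right_inv := fun _ => rfl }
  rw [Nat.card_congr e, Nat.card_eq_fintype_card]
  decide

/-- Triples of distinct elements of `s`. -/
def distinctTriples {V : Type*} [DecidableEq V] (s : Finset V) : Finset (V × V × V) :=
  (s ×ˢ s ×ˢ s).filter fun t => t.1 ≠ t.2.1 ∧ t.1 ≠ t.2.2 ∧ t.2.1 ≠ t.2.2

open Classical in
/-- The number of ordered 2-stars of `G` with nodes in `s`. -/
noncomputable def orderedStars {V : Type*} [DecidableEq V] (G : SimpleGraph V) (s : Finset V) : ℕ :=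
  ((distinctTriples s).filter fun t => G.Adj t.1 t.2.1 ∧ G.Adj t.1 t.2.2).card

open Classical in
/-- The number of ordered triangles of `G` with nodes in `s`. -/
noncomputable def orderedTriangles {V : Type*} [DecidableEq V] (G : SimpleGraph V) (s : Finset V) : ℕ :=
  ((distinctTriples s).filter fun t =>
    G.Adj t.1 t.2.1 ∧ G.Adj t.1 t.2.2 ∧ G.Adj t.2.1 t.2.2).card

/-- A labelled star is determined by the images of its centre and its two leaves. Pulling back along
an embedding covers induced subgraphs (subtype embedding) and the whole graph (identity) at once. -/
theorem two_mul_numTwoStars_comap [Fintype V] [DecidableEq W] (G : SimpleGraph W) (e : V ↪ W) :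
    2 * numTwoStars (G.comap e) = orderedStars G (Finset.univ.map e) := by
  classical
  rw [numTwoStars, mul_comm, ← natCard_aut_starGraph, ← labelledCopyCount_eq_copyCount_mul,
    orderedStars]
  obtain ⟨_, hcard⟩ := exists_labelledCopyCount_eq_card_univ (G.comap e)
    (SimpleGraph.starGraph (0 : Fin 3))
  rw [hcard]
  refine Finset.card_bij (fun f _ => (e (f 0), e (f 1), e (f 2))) ?_ ?_ ?_
  · intro f _
    have h1 : (G.comap e).Adj (f 0) (f 1) := f.toHom.map_adj (by decide)
    have h2 : (G.comap e).Adj (f 0) (f 2) := f.toHom.map_adj (by decide)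
    have h3 : f 1 ≠ f 2 := f.injective.ne (by decide)
    simp only [distinctTriples, Finset.mem_filter, Finset.mem_product, Finset.mem_map',
      Finset.mem_univ, true_and]
    exact ⟨⟨e.injective.ne h1.ne, e.injective.ne h2.ne, e.injective.ne h3⟩, h1, h2⟩
  · intro f _ g _ h
    simp only [Prod.mk.injEq, e.injective.eq_iff] at h
    exact SimpleGraph.Copy.ext (Fin.forall_fin_succ.2 ⟨h.1, Fin.forall_fin_two.2 h.2⟩)
  · rintro ⟨c, a, b⟩ ht
    simp only [distinctTriples, Finset.mem_filter, Finset.mem_product, Finset.mem_map,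
      Finset.mem_univ, true_and] at ht
    obtain ⟨⟨⟨⟨c, rfl⟩, ⟨a, rfl⟩, ⟨b, rfl⟩⟩, h1, h2, h3⟩, h4, h5⟩ := ht
    refine ⟨⟨⟨![c, a, b], ?_⟩, ?_⟩, Finset.mem_univ _, rfl⟩
    · intro x y hxy
      rw [SimpleGraph.starGraph_adj] at hxy
      rw [SimpleGraph.comap_adj]
      fin_cases x <;> fin_cases y <;> first | exact absurd hxy (by decide) | skip
      exacts [h4, h5, h4.symm, h5.symm]
    · have h1' : c ≠ a := fun h => h1 (h ▸ rfl)
      have h2' : c ≠ b := fun h => h2 (h ▸ rfl)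
      have h3' : a ≠ b := fun h => h3 (h ▸ rfl)
      intro x y hxy
      fin_cases x <;> fin_cases y <;> first | rfl | skip
      exacts [absurd hxy h1', absurd hxy h2', absurd hxy h1'.symm, absurd hxy h3',
        absurd hxy h2'.symm, absurd hxy h3'.symm]

theorem six_mul_numTriangles_comap [Fintype V] [DecidableEq W] (G : SimpleGraph W) (e : V ↪ W) :
    6 * numTriangles (G.comap e) = orderedTriangles G (Finset.univ.map e) := by
  classical
  rw [numTriangles, mul_comm, ← natCard_aut_completeGraph, ← labelledCopyCount_eq_copyCount_mul,
    orderedTriangles]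
  obtain ⟨_, hcard⟩ := exists_labelledCopyCount_eq_card_univ (G.comap e)
    (SimpleGraph.completeGraph (Fin 3))
  rw [hcard]
  refine Finset.card_bij (fun f _ => (e (f 0), e (f 1), e (f 2))) ?_ ?_ ?_
  · intro f _
    have h1 : (G.comap e).Adj (f 0) (f 1) := f.toHom.map_adj (by decide)
    have h2 : (G.comap e).Adj (f 0) (f 2) := f.toHom.map_adj (by decide)
    have h3 : (G.comap e).Adj (f 1) (f 2) := f.toHom.map_adj (by decide)
    simp only [distinctTriples, Finset.mem_filter, Finset.mem_product, Finset.mem_map',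
      Finset.mem_univ, true_and]
    exact ⟨⟨e.injective.ne h1.ne, e.injective.ne h2.ne, e.injective.ne h3.ne⟩, h1, h2, h3⟩
  · intro f _ g _ h
    simp only [Prod.mk.injEq, e.injective.eq_iff] at h
    exact SimpleGraph.Copy.ext (Fin.forall_fin_succ.2 ⟨h.1, Fin.forall_fin_two.2 h.2⟩)
  · rintro ⟨c, a, b⟩ ht
    simp only [distinctTriples, Finset.mem_filter, Finset.mem_product, Finset.mem_map,
      Finset.mem_univ, true_and] at ht
    obtain ⟨⟨⟨⟨c, rfl⟩, ⟨a, rfl⟩, ⟨b, rfl⟩⟩, -⟩, h4, h5, h6⟩ := ht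
    have hadj : ∀ x y : Fin 3, x ≠ y → (G.comap e).Adj (![c, a, b] x) (![c, a, b] y) := by
      intro x y hxy
      rw [SimpleGraph.comap_adj]
      fin_cases x <;> fin_cases y <;> first | exact absurd rfl hxy | skip
      exacts [h4, h5, h4.symm, h6, h5.symm, h6.symm]
    refine ⟨⟨⟨![c, a, b], fun {x y} hxy => hadj x y hxy⟩, ?_⟩, Finset.mem_univ _, rfl⟩
    intro x y hxy
    by_contra hne
    exact (hadj x y hne).ne hxy

theorem two_mul_numTwoStars_induce [DecidableEq V] (G : SimpleGraph V) (s : Finset V) :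
    2 * numTwoStars (G.induce (s : Set V)) = orderedStars G s := by
  refine (two_mul_numTwoStars_comap G (Function.Embedding.subtype (· ∈ (s : Set V)))).trans ?_
  congr 1
  ext x
  simp

theorem six_mul_numTriangles_induce [DecidableEq V] (G : SimpleGraph V) (s : Finset V) :
    6 * numTriangles (G.induce (s : Set V)) = orderedTriangles G s := by
  refine (six_mul_numTriangles_comap G (Function.Embedding.subtype (· ∈ (s : Set V)))).trans ?_
  congr 1
  ext x
  simp

theorem two_mul_numTwoStars [Fintype V] [DecidableEq V] (G : SimpleGraph V) :
    2 * numTwoStars G = orderedStars G Finset.univ :=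
  (two_mul_numTwoStars_comap G (Function.Embedding.refl V)).trans (by rw [Finset.map_refl])

theorem six_mul_numTriangles [Fintype V] [DecidableEq V] (G : SimpleGraph V) :
    6 * numTriangles G = orderedTriangles G Finset.univ :=
  (six_mul_numTriangles_comap G (Function.Embedding.refl V)).trans (by rw [Finset.map_refl])

theorem transitivity_induce [DecidableEq V] (G : SimpleGraph V) (s : Finset V) :
    transitivity (G.induce (s : Set V)) = (orderedTriangles G s : ℝ) / orderedStars G s := by
  rw [← two_mul_numTwoStars_induce, ← six_mul_numTriangles_induce, transitivity]
  push_cast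
  rw [← mul_div_assoc, show (6 : ℝ) = 2 * 3 by norm_num, mul_assoc,
    mul_div_mul_left _ _ two_ne_zero]

theorem transitivity_eq [Fintype V] [DecidableEq V] (G : SimpleGraph V) :
    transitivity G = (orderedTriangles G Finset.univ : ℝ) / orderedStars G Finset.univ := by
  rw [← two_mul_numTwoStars, ← six_mul_numTriangles, transitivity]
  push_cast
  rw [← mul_div_assoc, show (6 : ℝ) = 2 * 3 by norm_num, mul_assoc,
    mul_div_mul_left _ _ two_ne_zero]

theorem card_distinctTriples_le [DecidableEq V] (s : Finset V) :
    (distinctTriples s).card ≤ s.card ^ 3 := by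
  refine (Finset.card_filter_le _ _).trans_eq ?_
  simp only [Finset.card_product]
  ring

/-- A triple with a repetition lies in the image of `s ×ˢ s` under one of three maps, one for each
pair of equal coordinates. -/
theorem card_pow_three_le [DecidableEq V] (s : Finset V) :
    s.card ^ 3 ≤ (distinctTriples s).card + 3 * s.card ^ 2 := by
  have h : s ×ˢ s ×ˢ s ⊆ distinctTriples s ∪ ((s ×ˢ s).image (fun x => (x.1, x.1, x.2)) ∪
      ((s ×ˢ s).image (fun x => (x.1, x.2, x.1)) ∪ (s ×ˢ s).image (fun x => (x.1, x.2, x.2)))) := by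
    rintro ⟨c, a, b⟩ h
    simp only [distinctTriples, Finset.mem_union, Finset.mem_filter, Finset.mem_image,
      Finset.mem_product, Prod.mk.injEq, Prod.exists] at h ⊢
    by_cases h1 : c = a
    · exact Or.inr (Or.inl ⟨c, b, by tauto, rfl, h1, rfl⟩)
    by_cases h2 : c = b
    · exact Or.inr (Or.inr (Or.inl ⟨c, a, by tauto, rfl, rfl, h2⟩))
    by_cases h3 : a = b
    · exact Or.inr (Or.inr (Or.inr ⟨c, a, by tauto, rfl, rfl, h3⟩))
    exact Or.inl ⟨h, h1, h2, h3⟩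
  have hc (f : V × V → V × V × V) : ((s ×ˢ s).image f).card ≤ s.card ^ 2 :=
    Finset.card_image_le.trans_eq (by rw [Finset.card_product, sq])
  calc s.card ^ 3 = (s ×ˢ s ×ˢ s).card := by simp only [Finset.card_product]; ring
    _ ≤ _ := Finset.card_le_card h
    _ ≤ _ := Finset.card_union_le _ _
    _ ≤ (distinctTriples s).card + (s.card ^ 2 + (s.card ^ 2 + s.card ^ 2)) := by
      gcongr
      refine (Finset.card_union_le _ _).trans (add_le_add (hc _) ?_)
      exact (Finset.card_union_le _ _).trans (add_le_add (hc _) (hc _))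
    _ = _ := by ring

end Counting

/-! ### Independence of rows, and exploration bounds for sets of edges. -/

section AttributeMatrix

variable {Ω : Type*} {n m : ℕ}

/-- The event that all entries of the attribute matrix at positions in `F` are `1`. -/
def allOnes (B : Fin n → Fin m → Ω → ℕ) (F : Finset (Fin n × Fin m)) : Set Ω :=
  {ω | ∀ q ∈ F, B q.1 q.2 ω = 1}

/-- The event that the nodes `i` and `j` share an attribute. -/
def linked (B : Fin n → Fin m → Ω → ℕ) (i j : Fin n) : Set Ω :=
  {ω | ∃ k, B i k ω = 1 ∧ B j k ω = 1}

theorem linked_comm (B : Fin n → Fin m → Ω → ℕ) (i j : Fin n) : linked B i j = linked B j i := by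
  ext ω
  exact exists_congr fun k => and_comm

variable [MeasurableSpace Ω] {P : Measure Ω} {B : Fin n → Fin m → Ω → ℕ} {p : ℝ}

theorem randomIntersectionGraph_adj (hB : IsBinomialAttributeMatrix P B p) {i j : Fin n}
    (hij : i ≠ j) (ω : Ω) : (randomIntersectionGraph B ω).Adj i j ↔ ω ∈ linked B i j := by
  have h : (randomIntersectionGraph B ω).Adj i j ↔ 1 ≤ ∑ k, B i k ω * B j k ω := by
    simp [randomIntersectionGraph, intersectionGraph, hij]
  rw [h, Nat.one_le_iff_ne_zero, ne_eq, Finset.sum_eq_zero_iff]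
  simp only [Finset.mem_univ, true_imp_iff, not_forall, linked, Set.mem_ofPred_eq]
  refine exists_congr fun k => ?_
  rcases hB.zero_or_one i k ω with h1 | h1 <;> rcases hB.zero_or_one j k ω with h2 | h2 <;>
    simp [h1, h2]

theorem measurableSet_allOnes (hB : IsBinomialAttributeMatrix P B p)
    (F : Finset (Fin n × Fin m)) : MeasurableSet (allOnes B F) := by
  have : allOnes B F = ⋂ q ∈ F, B q.1 q.2 ⁻¹' {1} := by ext; simp [allOnes]
  rw [this]
  exact Finset.measurableSet_biInter _ fun q _ => hB.measurable _ _ (measurableSet_singleton _)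

theorem measureReal_eq_one (hB : IsBinomialAttributeMatrix P B p) (i : Fin n) (k : Fin m) :
    P.real (B i k ⁻¹' {1}) = p := by
  rw [← hB.mean i k, ← integral_indicator_one (hB.measurable i k (measurableSet_singleton _))]
  refine integral_congr_ae (ae_of_all _ fun ω => ?_)
  rcases hB.zero_or_one i k ω with h | h <;> simp [Set.indicator, h]

theorem measureReal_allOnes (hB : IsBinomialAttributeMatrix P B p)
    (F : Finset (Fin n × Fin m)) : P.real (allOnes B F) = p ^ F.card := by
  have h : allOnes B F = ⋂ q ∈ F, B q.1 q.2 ⁻¹' {1} := by ext; simp [allOnes]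
  rw [h, measureReal_def, hB.indep.measure_inter_preimage_eq_mul F
    (fun q _ => measurableSet_singleton _), ENNReal.toReal_prod, ← Finset.prod_const]
  exact Finset.prod_congr rfl fun q _ => measureReal_eq_one hB q.1 q.2

/-- The σ-algebra generated by the rows of the attribute matrix in `U`. -/
@[reducible] def rowSigma (B : Fin n → Fin m → Ω → ℕ) (U : Set (Fin n)) : MeasurableSpace Ω :=
  ⨆ q ∈ {q : Fin n × Fin m | q.1 ∈ U}, MeasurableSpace.comap (B q.1 q.2) inferInstance

omit [MeasurableSpace Ω] in
theorem measurableSet_rowSigma_linked {U : Set (Fin n)} {i j : Fin n} (hi : i ∈ U) (hj : j ∈ U) :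
    MeasurableSet[rowSigma B U] (linked B i j) := by
  have h : linked B i j = ⋃ k, B i k ⁻¹' {1} ∩ B j k ⁻¹' {1} := by ext; simp [linked]
  have key : ∀ i' ∈ U, ∀ k, MeasurableSet[rowSigma B U] (B i' k ⁻¹' {1}) := fun i' hi' k =>
    le_iSup₂_of_le (f := fun (q : Fin n × Fin m) (_ : q ∈ {q : Fin n × Fin m | q.1 ∈ U}) =>
      MeasurableSpace.comap (B q.1 q.2) inferInstance) (i', k) hi' le_rfl _
      ⟨{1}, measurableSet_singleton _, rfl⟩
  rw [h]
  exact MeasurableSet.iUnion fun k => (key i hi k).inter (key j hj k)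

theorem rowSigma_le (hB : IsBinomialAttributeMatrix P B p) (U : Set (Fin n)) :
    rowSigma B U ≤ ‹MeasurableSpace Ω› :=
  iSup₂_le fun q _ => (hB.measurable q.1 q.2).comap_le

theorem measurableSet_linked (hB : IsBinomialAttributeMatrix P B p) (i j : Fin n) :
    MeasurableSet (linked B i j) :=
  rowSigma_le hB Set.univ _ (measurableSet_rowSigma_linked trivial trivial)

theorem indep_rowSigma (hB : IsBinomialAttributeMatrix P B p) {U U' : Set (Fin n)}
    (h : Disjoint U U') : Indep (rowSigma B U) (rowSigma B U') P :=
  indep_iSup_of_disjoint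
    (m := fun q : Fin n × Fin m => MeasurableSpace.comap (B q.1 q.2) inferInstance)
    (S := {q | q.1 ∈ U}) (T := {q | q.1 ∈ U'}) (fun q => (hB.measurable q.1 q.2).comap_le)
    hB.indep.iIndep (Set.disjoint_left.2 fun _ hq hq' => Set.disjoint_left.1 h hq hq')

/-- Every edge in the list ends in a node which has not occurred before. -/
def IsGrowing : Finset (Fin n) → List (Fin n × Fin n) → Prop
  | _, [] => True
  | U, e :: L => e.2 ∉ U ∧ e.2 ≠ e.1 ∧ IsGrowing (insert e.1 (insert e.2 U)) L

/-- Apply the union bound over the attribute `k` witnessing the first edge `(u, w)`. Row `w` is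
untouched by `F`, so `(w, k)` always costs `p`; `(u, k)` costs another `p` unless it is already in
`F`, which happens for at most `N` values of `k`. Each edge therefore costs `p (N + m p)`. An edge
adds at most two positions, so the invariant `F.card + 2 * L.length ≤ N` survives the induction. -/
theorem measureReal_growing_le [IsProbabilityMeasure P] (hB : IsBinomialAttributeMatrix P B p)
    (hp : 0 ≤ p) (N : ℕ) (L : List (Fin n × Fin n)) :
    ∀ (U : Finset (Fin n)) (F : Finset (Fin n × Fin m)), (∀ q ∈ F, q.1 ∈ U) → IsGrowing U L →
      F.card + 2 * L.length ≤ N →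
      P.real (allOnes B F ∩ {ω | ∀ e ∈ L, ω ∈ linked B e.1 e.2}) ≤
        p ^ F.card * (p * (N + m * p)) ^ L.length := by
  induction L with
  | nil =>
    intro U F _ _ _
    simp [measureReal_allOnes hB]
  | cons e L ih =>
    obtain ⟨u, w⟩ := e
    intro U F hF hL hN
    obtain ⟨hwU, hwu, hL'⟩ := hL
    simp only at hwU hwu hL'
    simp only [List.length_cons] at hN ⊢
    set Q := (p * (N + m * p)) ^ L.length with hQ
    have hQ0 : 0 ≤ Q := by positivity
    have hw : ∀ k, (w, k) ∉ F := fun k hk => hwU (hF _ hk)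
    have hcard : ∀ k, (insert (u, k) (insert (w, k) F)).card =
        if (u, k) ∈ F then F.card + 1 else F.card + 2 := by
      intro k
      split_ifs with hk
      · rw [Finset.insert_eq_of_mem (Finset.mem_insert_of_mem hk),
          Finset.card_insert_of_notMem (hw k)]
      · rw [Finset.card_insert_of_notMem, Finset.card_insert_of_notMem (hw k)]
        simp [hk, hwu.symm]
    have hsub : allOnes B F ∩ {ω | ∀ e ∈ (u, w) :: L, ω ∈ linked B e.1 e.2} ⊆
        ⋃ k, allOnes B (insert (u, k) (insert (w, k) F)) ∩
          {ω | ∀ e ∈ L, ω ∈ linked B e.1 e.2} := by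
      rintro ω ⟨h1, h2⟩
      rw [Set.mem_ofPred_eq, List.forall_mem_cons] at h2
      obtain ⟨⟨k, hu, hw⟩, h3⟩ := h2
      rw [Set.mem_iUnion]
      refine ⟨k, ?_, h3⟩
      intro q hq
      rcases Finset.mem_insert.1 hq with rfl | hq
      · exact hu
      rcases Finset.mem_insert.1 hq with rfl | hq
      · exact hw
      · exact h1 q hq
    have hk_le : ∀ k, P.real (allOnes B (insert (u, k) (insert (w, k) F)) ∩
        {ω | ∀ e ∈ L, ω ∈ linked B e.1 e.2}) ≤
        p ^ (F.card + 1) * ((if (u, k) ∈ F then 1 else 0) + p) * Q := by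
      intro k
      refine (ih (insert u (insert w U)) _ ?_ hL' ?_).trans ?_
      · intro q hq
        rcases Finset.mem_insert.1 hq with rfl | hq
        · simp
        rcases Finset.mem_insert.1 hq with rfl | hq
        · simp
        · exact Finset.mem_insert_of_mem (Finset.mem_insert_of_mem (hF q hq))
      · rw [hcard]
        split_ifs <;> omega
      · refine mul_le_mul_of_nonneg_right ?_ hQ0
        rw [hcard]
        split_ifs
        · exact le_mul_of_one_le_right (by positivity) (by linarith)
        · exact le_of_eq (by ring)
    have hcount : (∑ k : Fin m, if (u, k) ∈ F then (1 : ℝ) else 0) ≤ N := by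
      rw [Finset.sum_boole]
      have : (Finset.univ.filter fun k => (u, k) ∈ F).card ≤ F.card :=
        Finset.card_le_card_of_injOn (fun k => (u, k)) (fun k hk => by simpa using hk)
          (fun k _ l _ h => (Prod.mk.inj h).2)
      exact_mod_cast this.trans (by omega)
    calc P.real (allOnes B F ∩ {ω | ∀ e ∈ (u, w) :: L, ω ∈ linked B e.1 e.2})
        ≤ P.real (⋃ k, allOnes B (insert (u, k) (insert (w, k) F)) ∩
          {ω | ∀ e ∈ L, ω ∈ linked B e.1 e.2}) := measureReal_mono hsub
      _ ≤ ∑ k, P.real (allOnes B (insert (u, k) (insert (w, k) F)) ∩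
          {ω | ∀ e ∈ L, ω ∈ linked B e.1 e.2}) := measureReal_iUnion_fintype_le _
      _ ≤ ∑ k : Fin m, p ^ (F.card + 1) * ((if (u, k) ∈ F then 1 else 0) + p) * Q :=
        Finset.sum_le_sum fun k _ => hk_le k
      _ = p ^ (F.card + 1) * ((∑ k : Fin m, if (u, k) ∈ F then (1 : ℝ) else 0) + m * p) * Q := by
        rw [← Finset.sum_mul, ← Finset.mul_sum, Finset.sum_add_distrib]
        simp
      _ ≤ p ^ (F.card + 1) * (N + m * p) * Q := by gcongr
      _ = _ := by rw [hQ]; ring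

theorem measureReal_linked_list_le [IsProbabilityMeasure P]
    (hB : IsBinomialAttributeMatrix P B p) (hp : 0 ≤ p) (L : List (Fin n × Fin n))
    (hL : IsGrowing ∅ L) (hlen : L.length ≤ 4) :
    P.real {ω | ∀ e ∈ L, ω ∈ linked B e.1 e.2} ≤ (p * (8 + m * p)) ^ L.length := by
  -- At most four edges with two positions each: hence the constant 8.
  have h := measureReal_growing_le hB hp 8 L ∅ ∅ (by simp) hL (by simp; omega)
  have h0 : allOnes B ∅ = Set.univ := by ext; simp [allOnes]
  simpa [h0] using h

/-- The event that `t` is an ordered 2-star. -/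
def starEvent (B : Fin n → Fin m → Ω → ℕ) (t : Fin n × Fin n × Fin n) : Set Ω :=
  linked B t.1 t.2.1 ∩ linked B t.1 t.2.2

/-- The event that `t` is an ordered triangle. -/
def triangleEvent (B : Fin n → Fin m → Ω → ℕ) (t : Fin n × Fin n × Fin n) : Set Ω :=
  starEvent B t ∩ linked B t.2.1 t.2.2

/-- The set of nodes of a triple. -/
def nodes {V : Type*} [DecidableEq V] (t : V × V × V) : Finset V := {t.1, t.2.1, t.2.2}

theorem measurableSet_starEvent (hB : IsBinomialAttributeMatrix P B p)
    (t : Fin n × Fin n × Fin n) : MeasurableSet (starEvent B t) :=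
  (measurableSet_linked hB _ _).inter (measurableSet_linked hB _ _)

theorem measurableSet_triangleEvent (hB : IsBinomialAttributeMatrix P B p)
    (t : Fin n × Fin n × Fin n) : MeasurableSet (triangleEvent B t) :=
  (measurableSet_starEvent hB t).inter (measurableSet_linked hB _ _)

omit [MeasurableSpace Ω] in
theorem measurableSet_rowSigma_starEvent (t : Fin n × Fin n × Fin n) :
    MeasurableSet[rowSigma B (nodes t : Set (Fin n))] (starEvent B t) :=
  MeasurableSet.inter (measurableSet_rowSigma_linked (by simp [nodes]) (by simp [nodes]))
    (measurableSet_rowSigma_linked (by simp [nodes]) (by simp [nodes]))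

omit [MeasurableSpace Ω] in
theorem measurableSet_rowSigma_triangleEvent (t : Fin n × Fin n × Fin n) :
    MeasurableSet[rowSigma B (nodes t : Set (Fin n))] (triangleEvent B t) :=
  MeasurableSet.inter (measurableSet_rowSigma_starEvent t)
    (measurableSet_rowSigma_linked (by simp [nodes]) (by simp [nodes]))

theorem measureReal_inter_of_disjoint (hB : IsBinomialAttributeMatrix P B p)
    {A A' : Set Ω} {U U' : Finset (Fin n)} (h : Disjoint U U')
    (hA : MeasurableSet[rowSigma B (U : Set (Fin n))] A)
    (hA' : MeasurableSet[rowSigma B (U' : Set (Fin n))] A') :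
    P.real (A ∩ A') = P.real A * P.real A' := by
  simp only [measureReal_def, ← ENNReal.toReal_mul]
  rw [(Indep_iff _ _ _).1 (indep_rowSigma hB (Finset.disjoint_coe.2 h)) A A' hA hA']

/-- The weight of a node in a star which overlaps the triple `t`. -/
noncomputable def overlapWeight {V : Type*} [DecidableEq V] (q : ℝ) (t : V × V × V) (x : V) : ℝ :=
  if x ∈ nodes t then 1 else q

/-- The two edges of `t` give `q ^ 2`. From the nodes of `t`, the star `t'` is explored outwards
from a shared node, one edge per new node; edges of `t'` not needed to reach a new node are
discarded. -/
theorem measureReal_starEvent_inter_le [IsProbabilityMeasure P]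
    (hB : IsBinomialAttributeMatrix P B p) (hp : 0 ≤ p) {s : Finset (Fin n)}
    {t t' : Fin n × Fin n × Fin n} (ht : t ∈ distinctTriples s) (ht' : t' ∈ distinctTriples s)
    (h : ¬ Disjoint (nodes t) (nodes t')) :
    P.real (starEvent B t ∩ starEvent B t') ≤ (p * (8 + m * p)) ^ 2 *
      (overlapWeight (p * (8 + m * p)) t t'.1 * (overlapWeight (p * (8 + m * p)) t t'.2.1 *
        overlapWeight (p * (8 + m * p)) t t'.2.2)) := by
  obtain ⟨c, a, b⟩ := t
  obtain ⟨c', a', b'⟩ := t'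
  simp only [distinctTriples, Finset.mem_filter] at ht ht'
  obtain ⟨-, h1, h2, h3⟩ := ht
  obtain ⟨-, h1', h2', h3'⟩ := ht'
  simp only [overlapWeight]
  have key : ∀ L : List (Fin n × Fin n), L.length ≤ 2 → IsGrowing {a, c, b} L →
      (∀ e ∈ L, starEvent B (c', a', b') ⊆ linked B e.1 e.2) →
      P.real (starEvent B (c, a, b) ∩ starEvent B (c', a', b')) ≤
        (p * (8 + m * p)) ^ (L.length + 2) := by
    intro L hlen hL hsub
    refine (measureReal_mono ?_).trans
      (measureReal_linked_list_le hB hp ((c, a) :: (c, b) :: L) ?_ (by simp; omega))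
    · rintro ω ⟨⟨hω1, hω2⟩, hω'⟩ e he
      rcases List.mem_cons.1 he with rfl | he
      · exact hω1
      rcases List.mem_cons.1 he with rfl | he
      · exact hω2
      · exact hsub e he hω'
    · refine ⟨by simp, h1.symm, by simp [h2.symm, h3.symm], h2.symm, ?_⟩
      convert hL using 1
      ext x
      simp
      tauto
  have hca : starEvent B (c', a', b') ⊆ linked B c' a' := Set.inter_subset_left
  have hcb : starEvent B (c', a', b') ⊆ linked B c' b' := Set.inter_subset_right
  have hac : starEvent B (c', a', b') ⊆ linked B a' c' := linked_comm B c' a' ▸ hca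
  have hbc : starEvent B (c', a', b') ⊆ linked B b' c' := linked_comm B c' b' ▸ hcb
  have hn : ∀ x, x ∈ nodes (c, a, b) ↔ x ∈ ({a, c, b} : Finset (Fin n)) := by
    intro x; simp [nodes]; tauto
  simp only [hn]
  simp only [ne_eq] at h1' h2' h3'
  have hne : c' ∈ ({a, c, b} : Finset (Fin n)) ∨ a' ∈ ({a, c, b} : Finset (Fin n)) ∨
      b' ∈ ({a, c, b} : Finset (Fin n)) := by
    by_contra hcon
    push Not at hcon
    refine h (Finset.disjoint_right.2 fun x hx => ?_)
    rw [hn]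
    simp only [nodes, Finset.mem_insert, Finset.mem_singleton] at hx
    rcases hx with rfl | rfl | rfl
    exacts [hcon.1, hcon.2.1, hcon.2.2]
  generalize ({a, c, b} : Finset (Fin n)) = U at key hne ⊢
  -- A new centre is entered first, from a leaf already in `U` through a reversed edge; new leaves
  -- are then entered from the centre.
  by_cases hc' : c' ∈ U <;> by_cases ha' : a' ∈ U <;> by_cases hb' : b' ∈ U
  · refine (key [] (by simp) trivial (by simp)).trans (le_of_eq ?_)
    simp [hc', ha', hb']
  · refine (key [(c', b')] (by simp) ⟨hb', Ne.symm h2', trivial⟩ (by simpa using hcb)).trans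
      (le_of_eq ?_)
    simp [hc', ha', hb']; ring
  · refine (key [(c', a')] (by simp) ⟨ha', Ne.symm h1', trivial⟩ (by simpa using hca)).trans
      (le_of_eq ?_)
    simp [hc', ha', hb']; ring
  · refine (key [(c', a'), (c', b')] (by simp) ⟨ha', Ne.symm h1', ?_, Ne.symm h2', trivial⟩
      (by simpa using ⟨hca, hcb⟩)).trans (le_of_eq ?_)
    · simp [hb', Ne.symm h2', Ne.symm h3']
    · simp [hc', ha', hb']; ring
  · refine (key [(a', c')] (by simp) ⟨hc', h1', trivial⟩ (by simpa using hac)).trans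
      (le_of_eq ?_)
    simp [hc', ha', hb']; ring
  · refine (key [(a', c'), (c', b')] (by simp) ⟨hc', h1', ?_, Ne.symm h2', trivial⟩
      (by simpa using ⟨hac, hcb⟩)).trans (le_of_eq ?_)
    · simp [hb', Ne.symm h2', Ne.symm h3']
    · simp [hc', ha', hb']; ring
  · refine (key [(b', c'), (c', a')] (by simp) ⟨hc', h2', ?_, Ne.symm h1', trivial⟩
      (by simpa using ⟨hbc, hca⟩)).trans (le_of_eq ?_)
    · simp [ha', Ne.symm h1', h3']
    · simp [hc', ha', hb']; ring
  · exact absurd hne (by simp [hc', ha', hb'])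

end AttributeMatrix

/-! ### Variance bounds and Chebyshev's inequality for stars and triangles. -/

section SecondMoment

theorem sum_product_mul {V : Type*} (s : Finset V) (f g h : V → ℝ) :
    ∑ t ∈ s ×ˢ s ×ˢ s, f t.1 * (g t.2.1 * h t.2.2) =
      (∑ x ∈ s, f x) * ((∑ x ∈ s, g x) * ∑ x ∈ s, h x) := by
  simp only [Finset.sum_product, ← Finset.mul_sum, ← Finset.sum_mul]

theorem card_nodes_le {V : Type*} [DecidableEq V] (t : V × V × V) : (nodes t).card ≤ 3 :=
  Finset.card_le_three

theorem sum_ite_mem_nodes_le {V : Type*} [DecidableEq V] (s : Finset V) (t : V × V × V) :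
    (∑ x ∈ s, if x ∈ nodes t then (1 : ℝ) else 0) ≤ 3 := by
  rw [Finset.sum_boole]
  refine (Nat.cast_le.2 ((Finset.card_le_card ?_).trans (card_nodes_le t))).trans_eq (by norm_num)
  intro x hx
  exact (Finset.mem_filter.1 hx).2

theorem sum_overlapWeight_le {V : Type*} [DecidableEq V] {q : ℝ} (hq : 0 ≤ q) (s : Finset V)
    (t : V × V × V) : ∑ x ∈ s, overlapWeight q t x ≤ 3 + s.card * q := by
  have h : ∀ x ∈ s, overlapWeight q t x ≤ (if x ∈ nodes t then (1 : ℝ) else 0) + q := by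
    intro x _
    unfold overlapWeight
    split_ifs <;> linarith
  refine (Finset.sum_le_sum h).trans ?_
  rw [Finset.sum_add_distrib, Finset.sum_const, nsmul_eq_mul]
  linarith [sum_ite_mem_nodes_le s t]

/-- An overlapping triple has a coordinate among the nodes of `t`, where the weight equals the
indicator `f`. Its weight is thus at most the sum of three products, each with one factor `w`
replaced by `f`, and these sums factorize. Three choices of the coordinate times `∑ f ≤ 3` give the
9. -/
theorem sum_overlapping_le {V : Type*} [DecidableEq V] {q : ℝ} (hq : 0 ≤ q) (s : Finset V)
    (t : V × V × V) :
    ∑ t' ∈ (distinctTriples s).filter (fun t' => ¬ Disjoint (nodes t) (nodes t')),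
      overlapWeight q t t'.1 * (overlapWeight q t t'.2.1 * overlapWeight q t t'.2.2) ≤
      9 * (3 + s.card * q) ^ 2 := by
  set w := overlapWeight q t with hw
  set f : V → ℝ := fun x => if x ∈ nodes t then 1 else 0 with hf
  have hw0 : ∀ x, 0 ≤ w x := by
    intro x
    simp only [hw, overlapWeight]
    split_ifs <;> linarith
  have hf0 : ∀ x, 0 ≤ f x := by
    intro x
    simp only [hf]
    split_ifs <;> linarith
  have hfw : ∀ x ∈ nodes t, w x = f x := by
    intro x hx
    simp [hw, overlapWeight, hf, hx]
  have hF : ∑ x ∈ s, f x ≤ 3 := sum_ite_mem_nodes_le s t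
  have hF0 : 0 ≤ ∑ x ∈ s, f x := Finset.sum_nonneg fun x _ => hf0 x
  have hW : ∑ x ∈ s, w x ≤ 3 + s.card * q := sum_overlapWeight_le hq s t
  have hW0 : 0 ≤ ∑ x ∈ s, w x := Finset.sum_nonneg fun x _ => hw0 x
  calc _ ≤ ∑ t' ∈ (distinctTriples s).filter (fun t' => ¬ Disjoint (nodes t) (nodes t')),
        (f t'.1 * (w t'.2.1 * w t'.2.2) + (w t'.1 * (f t'.2.1 * w t'.2.2) +
          w t'.1 * (w t'.2.1 * f t'.2.2))) := by
        refine Finset.sum_le_sum fun t' ht' => ?_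
        have hdis := (Finset.mem_filter.1 ht').2
        have p1 : 0 ≤ f t'.1 * (w t'.2.1 * w t'.2.2) :=
          mul_nonneg (hf0 _) (mul_nonneg (hw0 _) (hw0 _))
        have p2 : 0 ≤ w t'.1 * (f t'.2.1 * w t'.2.2) :=
          mul_nonneg (hw0 _) (mul_nonneg (hf0 _) (hw0 _))
        have p3 : 0 ≤ w t'.1 * (w t'.2.1 * f t'.2.2) :=
          mul_nonneg (hw0 _) (mul_nonneg (hw0 _) (hf0 _))
        obtain ⟨x, hx, hx'⟩ := Finset.not_disjoint_iff.1 hdis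
        simp only [nodes, Finset.mem_insert, Finset.mem_singleton] at hx'
        rcases hx' with rfl | rfl | rfl
        · rw [← hfw _ hx] at p1 ⊢; linarith
        · rw [← hfw _ hx] at p2 ⊢; linarith
        · rw [← hfw _ hx] at p3 ⊢; linarith
    _ ≤ ∑ t' ∈ s ×ˢ s ×ˢ s,
        (f t'.1 * (w t'.2.1 * w t'.2.2) + (w t'.1 * (f t'.2.1 * w t'.2.2) +
          w t'.1 * (w t'.2.1 * f t'.2.2))) := by
        refine Finset.sum_le_sum_of_subset_of_nonneg
          ((Finset.filter_subset _ _).trans (Finset.filter_subset _ _)) fun t' _ _ => ?_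
        have := hw0 t'.1
        have := hw0 t'.2.1
        have := hw0 t'.2.2
        have := hf0 t'.1
        have := hf0 t'.2.1
        have := hf0 t'.2.2
        positivity
    _ = 3 * ((∑ x ∈ s, f x) * ((∑ x ∈ s, w x) * ∑ x ∈ s, w x)) := by
        rw [Finset.sum_add_distrib, Finset.sum_add_distrib, sum_product_mul, sum_product_mul,
          sum_product_mul]
        ring
    _ ≤ 3 * (3 * ((3 + s.card * q) * (3 + s.card * q))) := by gcongr
    _ = _ := by ring

variable {Ω : Type*} [MeasurableSpace Ω] {P : Measure Ω}

theorem integrable_indicator_one [IsFiniteMeasure P] {A : Set Ω} (hA : MeasurableSet A) :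
    Integrable (A.indicator (1 : Ω → ℝ)) P :=
  (integrable_const (1 : ℝ)).indicator hA

theorem integral_sum_indicator_one [IsFiniteMeasure P] {ι : Type*} (T : Finset ι)
    {A : ι → Set Ω} (hA : ∀ i, MeasurableSet (A i)) :
    ∫ ω, ∑ i ∈ T, (A i).indicator (1 : Ω → ℝ) ω ∂P = ∑ i ∈ T, P.real (A i) := by
  rw [integral_finsetSum _ fun i _ => integrable_indicator_one (hA i)]
  exact Finset.sum_congr rfl fun i _ => integral_indicator_one (hA i)

/-- Chebyshev's inequality for a sum of indicators most pairs of which are uncorrelated. -/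
theorem measureReal_abs_sum_indicator_sub_ge_le [IsProbabilityMeasure P] {ι : Type*}
    (T : Finset ι) {A : ι → Set Ω} (hA : ∀ i, MeasurableSet (A i)) (R : ι → ι → Prop)
    [∀ i, DecidablePred (R i)]
    (hR : ∀ i ∈ T, ∀ j ∈ T, ¬ R i j → P.real (A i ∩ A j) = P.real (A i) * P.real (A j))
    {v : ℝ} (hv : ∑ i ∈ T, ∑ j ∈ T.filter (R i), P.real (A i ∩ A j) ≤ v) {δ : ℝ} (hδ : 0 < δ) :
    P.real {ω | δ ≤ |∑ i ∈ T, (A i).indicator (1 : Ω → ℝ) ω - ∑ i ∈ T, P.real (A i)|} ≤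
      v / δ ^ 2 := by
  set X : Ω → ℝ := fun ω => ∑ i ∈ T, (A i).indicator (1 : Ω → ℝ) ω with hX
  have hmean : P[X] = ∑ i ∈ T, P.real (A i) := integral_sum_indicator_one T hA
  have hmem : MemLp X 2 P := by
    refine memLp_finsetSum T fun i _ => ?_
    exact (memLp_const (1 : ℝ)).indicator (hA i)
  have hsq : P[X ^ 2] = ∑ i ∈ T, ∑ j ∈ T, P.real (A i ∩ A j) := by
    have : ∀ ω, (X ^ 2) ω = ∑ i ∈ T, ∑ j ∈ T, (A i ∩ A j).indicator (1 : Ω → ℝ) ω := by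
      intro ω
      simp only [Pi.pow_apply, hX, sq, Finset.sum_mul_sum]
      refine Finset.sum_congr rfl fun i _ => Finset.sum_congr rfl fun j _ => ?_
      rw [Set.inter_indicator_one, Pi.mul_apply]
    rw [integral_congr_ae (ae_of_all _ this), integral_finsetSum _ fun i _ =>
      integrable_finsetSum _ fun j _ => integrable_indicator_one ((hA i).inter (hA j))]
    exact Finset.sum_congr rfl fun i _ =>
      integral_sum_indicator_one T fun j => (hA i).inter (hA j)
  -- The variance is a double sum of covariances: zero for pairs outside `R`, and at most the joint
  -- probability for the others.
  have hvar : Var[X; P] ≤ v := by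
    rw [variance_eq_sub hmem, hsq, hmean, sq, Finset.sum_mul_sum, ← Finset.sum_sub_distrib]
    refine le_trans (Finset.sum_le_sum fun i hi => ?_) hv
    rw [← Finset.sum_sub_distrib, Finset.sum_filter]
    refine Finset.sum_le_sum fun j hj => ?_
    split_ifs with h
    · exact sub_le_self _ (mul_nonneg measureReal_nonneg measureReal_nonneg)
    · rw [hR i hi j hj h, sub_self]
  have hv0 : 0 ≤ v := (variance_nonneg X P).trans hvar
  have h := meas_ge_le_variance_div_sq hmem hδ
  rw [hmean] at h
  rw [measureReal_def]
  refine (ENNReal.toReal_mono ENNReal.ofReal_ne_top h).trans ?_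
  rw [ENNReal.toReal_ofReal (div_nonneg (variance_nonneg X P) (sq_nonneg δ))]
  gcongr

variable {n m : ℕ} {B : Fin n → Fin m → Ω → ℕ} {p : ℝ}

/-- With `q = O(1/n)` and `s.card ≤ n` the bound is `O(s.card ^ 3 / n ^ 2)`, the same order as the
mean. This makes Chebyshev effective as soon as the mean diverges. -/
theorem sum_overlapping_starEvent_le [IsProbabilityMeasure P]
    (hB : IsBinomialAttributeMatrix P B p) (hp : 0 ≤ p) (s : Finset (Fin n)) :
    ∑ t ∈ distinctTriples s, ∑ t' ∈ (distinctTriples s).filter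
      (fun t' => ¬ Disjoint (nodes t) (nodes t')), P.real (starEvent B t ∩ starEvent B t') ≤
      s.card ^ 3 * ((p * (8 + m * p)) ^ 2 * (9 * (3 + s.card * (p * (8 + m * p))) ^ 2)) := by
  have hq : 0 ≤ p * (8 + m * p) := by positivity
  calc _ ≤ ∑ t ∈ distinctTriples s,
        (p * (8 + m * p)) ^ 2 * (9 * (3 + s.card * (p * (8 + m * p))) ^ 2) := by
        refine Finset.sum_le_sum fun t ht => ?_
        refine le_trans (Finset.sum_le_sum fun t' ht' => ?_)
          (le_trans (Finset.mul_sum _ _ _).ge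
            (mul_le_mul_of_nonneg_left (sum_overlapping_le hq s t) (sq_nonneg _)))
        obtain ⟨h1, h2⟩ := Finset.mem_filter.1 ht'
        exact measureReal_starEvent_inter_le hB hp ht h1 h2
    _ ≤ _ := by
        rw [Finset.sum_const, nsmul_eq_mul]
        gcongr
        exact_mod_cast card_distinctTriples_le s

theorem sum_indicator_starEvent (hB : IsBinomialAttributeMatrix P B p) (s : Finset (Fin n))
    (ω : Ω) : ∑ t ∈ distinctTriples s, (starEvent B t).indicator (1 : Ω → ℝ) ω =
      orderedStars (randomIntersectionGraph B ω) s := by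
  classical
  rw [orderedStars, Finset.card_filter, Nat.cast_sum]
  refine Finset.sum_congr rfl fun t ht => ?_
  obtain ⟨-, h1, h2, -⟩ := Finset.mem_filter.1 ht
  rw [randomIntersectionGraph_adj hB h1, randomIntersectionGraph_adj hB h2]
  simp [Set.indicator, starEvent]

theorem sum_indicator_triangleEvent (hB : IsBinomialAttributeMatrix P B p) (s : Finset (Fin n))
    (ω : Ω) : ∑ t ∈ distinctTriples s, (triangleEvent B t).indicator (1 : Ω → ℝ) ω =
      orderedTriangles (randomIntersectionGraph B ω) s := by
  classical
  rw [orderedTriangles, Finset.card_filter, Nat.cast_sum]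
  refine Finset.sum_congr rfl fun t ht => ?_
  obtain ⟨-, h1, h2, h3⟩ := Finset.mem_filter.1 ht
  rw [randomIntersectionGraph_adj hB h1, randomIntersectionGraph_adj hB h2,
    randomIntersectionGraph_adj hB h3]
  simp [Set.indicator, starEvent, triangleEvent, and_assoc]

theorem measureReal_abs_orderedStars_sub_ge_le [IsProbabilityMeasure P]
    (hB : IsBinomialAttributeMatrix P B p) (hp : 0 ≤ p) (s : Finset (Fin n)) {δ : ℝ}
    (hδ : 0 < δ) :
    P.real {ω | δ ≤ |(orderedStars (randomIntersectionGraph B ω) s : ℝ) -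
      ∑ t ∈ distinctTriples s, P.real (starEvent B t)|} ≤
      s.card ^ 3 * ((p * (8 + m * p)) ^ 2 * (9 * (3 + s.card * (p * (8 + m * p))) ^ 2)) /
        δ ^ 2 := by
  simp only [← sum_indicator_starEvent hB]
  exact measureReal_abs_sum_indicator_sub_ge_le _ (measurableSet_starEvent hB)
    (fun t t' => ¬ Disjoint (nodes t) (nodes t'))
    (fun t _ t' _ h => measureReal_inter_of_disjoint hB (not_not.1 h)
      (measurableSet_rowSigma_starEvent t) (measurableSet_rowSigma_starEvent t'))
    (sum_overlapping_starEvent_le hB hp s) hδ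

/-- A triangle contains its star, so the star bound on overlapping pairs serves again. -/
theorem measureReal_abs_orderedTriangles_sub_ge_le [IsProbabilityMeasure P]
    (hB : IsBinomialAttributeMatrix P B p) (hp : 0 ≤ p) (s : Finset (Fin n)) {δ : ℝ}
    (hδ : 0 < δ) :
    P.real {ω | δ ≤ |(orderedTriangles (randomIntersectionGraph B ω) s : ℝ) -
      ∑ t ∈ distinctTriples s, P.real (triangleEvent B t)|} ≤
      s.card ^ 3 * ((p * (8 + m * p)) ^ 2 * (9 * (3 + s.card * (p * (8 + m * p))) ^ 2)) /
        δ ^ 2 := by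
  simp only [← sum_indicator_triangleEvent hB]
  refine measureReal_abs_sum_indicator_sub_ge_le _ (measurableSet_triangleEvent hB)
    (fun t t' => ¬ Disjoint (nodes t) (nodes t'))
    (fun t _ t' _ h => measureReal_inter_of_disjoint hB (not_not.1 h)
      (measurableSet_rowSigma_triangleEvent t) (measurableSet_rowSigma_triangleEvent t'))
    (le_trans (Finset.sum_le_sum fun t _ => Finset.sum_le_sum fun t' _ => ?_)
      (sum_overlapping_starEvent_le hB hp s)) hδ
  exact measureReal_mono (Set.inter_subset_inter Set.inter_subset_left Set.inter_subset_left)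

theorem integral_orderedStars [IsProbabilityMeasure P]
    (hB : IsBinomialAttributeMatrix P B p) (s : Finset (Fin n)) :
    ∫ ω, (orderedStars (randomIntersectionGraph B ω) s : ℝ) ∂P =
      ∑ t ∈ distinctTriples s, P.real (starEvent B t) := by
  simp only [← sum_indicator_starEvent hB]
  exact integral_sum_indicator_one _ (measurableSet_starEvent hB)

theorem integral_orderedTriangles [IsProbabilityMeasure P]
    (hB : IsBinomialAttributeMatrix P B p) (s : Finset (Fin n)) :
    ∫ ω, (orderedTriangles (randomIntersectionGraph B ω) s : ℝ) ∂P =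
      ∑ t ∈ distinctTriples s, P.real (triangleEvent B t) := by
  simp only [← sum_indicator_triangleEvent hB]
  exact integral_sum_indicator_one _ (measurableSet_triangleEvent hB)

end SecondMoment

/-! ### Star and triangle probabilities by inclusion-exclusion over witnessing attributes. -/

section FirstMoment

/-- At most `2 m²` triples have their last attribute equal to one of the first two; the remaining
ones number at most `m³` and carry the smaller weight `p ^ 6`. -/
theorem sum_triples_le {m : ℕ} {p : ℝ} (hp : 0 ≤ p) (F : (Fin m × Fin m) × Fin m → ℝ)
    (T : Finset ((Fin m × Fin m) × Fin m)) (h5 : ∀ x ∈ T, F x ≤ p ^ 5)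
    (h6 : ∀ x ∈ T, x.2 ≠ x.1.1 → x.2 ≠ x.1.2 → F x ≤ p ^ 6) :
    ∑ x ∈ T, F x ≤ 2 * m ^ 2 * p ^ 5 + m ^ 3 * p ^ 6 := by
  have hp5 : 0 ≤ p ^ 5 := by positivity
  have hp6 : 0 ≤ p ^ 6 := by positivity
  set g : (Fin m × Fin m) × Fin m → ℝ := fun x =>
    (if x.2 = x.1.1 then p ^ 5 else 0) + ((if x.2 = x.1.2 then p ^ 5 else 0) + p ^ 6) with hg
  calc ∑ x ∈ T, F x ≤ ∑ x ∈ T, g x := by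
        refine Finset.sum_le_sum fun x hx => ?_
        simp only [hg]
        split_ifs with h1 h2 h2
        · linarith [h5 x hx]
        · linarith [h5 x hx]
        · linarith [h5 x hx]
        · linarith [h6 x hx h1 h2]
    _ ≤ ∑ x, g x := by
        refine Finset.sum_le_sum_of_subset_of_nonneg (Finset.subset_univ _) fun x _ _ => ?_
        simp only [hg]
        split_ifs <;> linarith
    _ = _ := by
        simp only [hg, Fintype.sum_prod_type, Finset.sum_add_distrib, Finset.sum_ite_eq',
          Finset.mem_univ, if_true, Finset.sum_const, Finset.card_univ, Fintype.card_prod,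
          Fintype.card_fin, nsmul_eq_mul, Nat.cast_mul]
        ring

variable {n m : ℕ}

/-- The positions in the attribute matrix which witness that the pairs `e₁`, `e₂`, `e₃` share the
attributes `x.1.1`, `x.1.2`, `x.2`, respectively. -/
def witness (e₁ e₂ e₃ : Fin n × Fin n) (x : (Fin m × Fin m) × Fin m) :
    Finset (Fin n × Fin m) :=
  {(e₁.1, x.1.1), (e₁.2, x.1.1), (e₂.1, x.1.2), (e₂.2, x.1.2), (e₃.1, x.2), (e₃.2, x.2)}

/-- Two distinct attributes shared by `c` and `a` fill four positions and `(b, l)` is a fifth; `(c,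
l)` is a sixth unless `l` repeats an attribute. -/
theorem sum_witness_star_le {p : ℝ} (hp : 0 ≤ p) (hp1 : p ≤ 1) {c a b : Fin n} (hca : c ≠ a)
    (hcb : c ≠ b) (hab : a ≠ b) :
    ∑ x ∈ (Finset.univ : Finset (Fin m)).offDiag ×ˢ Finset.univ,
      p ^ (witness (c, a) (c, a) (c, b) x).card ≤ 2 * m ^ 2 * p ^ 5 + m ^ 3 * p ^ 6 := by
  refine sum_triples_le hp _ _ ?_ ?_
  · rintro ⟨⟨k, k'⟩, l⟩ hx
    have hk : k ≠ k' := by simpa using hx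
    refine pow_le_pow_of_le_one hp hp1 ?_
    have h : ({(c, k), (a, k), (c, k'), (a, k'), (b, l)} : Finset (Fin n × Fin m)).card = 5 := by
      simp [Finset.card_insert_of_notMem, hca, hcb, hab, hk, hca.symm]
    rw [← h]
    refine Finset.card_le_card fun q hq => ?_
    simp only [witness, Finset.mem_insert, Finset.mem_singleton] at hq ⊢
    tauto
  · rintro ⟨⟨k, k'⟩, l⟩ hx hl hl'
    have hk : k ≠ k' := by simpa using hx
    simp only at hl hl'
    refine pow_le_pow_of_le_one hp hp1 (le_of_eq ?_)
    simp [witness, Finset.card_insert_of_notMem, hca, hcb, hab, hk, hca.symm, hl.symm, hl'.symm]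

/-- Distinct attributes for `ca` and `cb` fill four positions. The edge `ab` adds `(b, l)` if `l =
k` and `(a, l)` otherwise, and adds both if `l` is a third attribute. -/
theorem sum_witness_triangle_le {p : ℝ} (hp : 0 ≤ p) (hp1 : p ≤ 1) {c a b : Fin n} (hca : c ≠ a)
    (hcb : c ≠ b) (hab : a ≠ b) :
    ∑ x ∈ (Finset.univ : Finset (Fin m)).offDiag ×ˢ Finset.univ,
      p ^ (witness (c, a) (c, b) (a, b) x).card ≤ 2 * m ^ 2 * p ^ 5 + m ^ 3 * p ^ 6 := by
  refine sum_triples_le hp _ _ ?_ ?_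
  · rintro ⟨⟨k, k'⟩, l⟩ hx
    have hk : k ≠ k' := by simpa using hx
    refine pow_le_pow_of_le_one hp hp1 ?_
    by_cases hl : l = k
    · subst hl
      have h : ({(c, l), (a, l), (c, k'), (b, k'), (b, l)} : Finset (Fin n × Fin m)).card =
          5 := by
        simp [Finset.card_insert_of_notMem, hca, hcb, hab, hk, hca.symm, hk.symm]
      rw [← h]
      refine Finset.card_le_card fun q hq => ?_
      simp only [witness, Finset.mem_insert, Finset.mem_singleton] at hq ⊢
      tauto
    · have h : ({(c, k), (a, k), (c, k'), (b, k'), (a, l)} : Finset (Fin n × Fin m)).card =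
          5 := by
        simp [Finset.card_insert_of_notMem, hca, hcb, hab, hk, hca.symm, hab.symm, Ne.symm hl]
      rw [← h]
      refine Finset.card_le_card fun q hq => ?_
      simp only [witness, Finset.mem_insert, Finset.mem_singleton] at hq ⊢
      tauto
  · rintro ⟨⟨k, k'⟩, l⟩ hx hl hl'
    have hk : k ≠ k' := by simpa using hx
    simp only at hl hl'
    refine pow_le_pow_of_le_one hp hp1 (le_of_eq ?_)
    simp [witness, Finset.card_insert_of_notMem, hca, hcb, hab, hk, hca.symm, hab.symm, hl.symm,
      hl'.symm]

variable {Ω : Type*} [MeasurableSpace Ω] {P : Measure Ω} [IsProbabilityMeasure P]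
  {B : Fin n → Fin m → Ω → ℕ} {p : ℝ}

open Classical in
/-- A first-moment form of the Bonferroni inequality. -/
theorem sum_pow_card_le_of_card_le (hB : IsBinomialAttributeMatrix P B p)
    {ι κ : Type} (I : Finset ι) (F : ι → Finset (Fin n × Fin m)) (J J' : Finset κ)
    (G G' : κ → Finset (Fin n × Fin m)) {E : Set Ω} (hE : MeasurableSet E)
    (h : ∀ ω, (I.filter fun i => ω ∈ allOnes B (F i)).card ≤ (if ω ∈ E then 1 else 0) +
      ((J.filter fun j => ω ∈ allOnes B (G j)).card +
        (J'.filter fun j => ω ∈ allOnes B (G' j)).card)) :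
    ∑ i ∈ I, p ^ (F i).card ≤
      P.real E + (∑ j ∈ J, p ^ (G j).card + ∑ j ∈ J', p ^ (G' j).card) := by
  have hint : ∀ A : Set Ω, MeasurableSet A → Integrable (A.indicator (1 : Ω → ℝ)) P :=
    fun A hA => (integrable_const (1 : ℝ)).indicator hA
  have hsum : ∀ {α : Type} (I : Finset α) (F : α → Finset (Fin n × Fin m)),
      Integrable (fun ω => ∑ i ∈ I, (allOnes B (F i)).indicator (1 : Ω → ℝ) ω) P :=
    fun I F => integrable_finsetSum _ fun i _ => hint _ (measurableSet_allOnes hB _)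
  have hval : ∀ {α : Type} (I : Finset α) (F : α → Finset (Fin n × Fin m)),
      ∫ ω, ∑ i ∈ I, (allOnes B (F i)).indicator (1 : Ω → ℝ) ω ∂P = ∑ i ∈ I, p ^ (F i).card := by
    intro α I F
    rw [integral_finsetSum _ fun i _ => hint _ (measurableSet_allOnes hB _)]
    refine Finset.sum_congr rfl fun i _ => ?_
    rw [integral_indicator_one (measurableSet_allOnes hB _), measureReal_allOnes hB]
  have hcard : ∀ {α : Type} (I : Finset α) (F : α → Finset (Fin n × Fin m)) (ω : Ω),
      ((I.filter fun i => ω ∈ allOnes B (F i)).card : ℝ) =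
        ∑ i ∈ I, (allOnes B (F i)).indicator (1 : Ω → ℝ) ω := by
    intro α I F ω
    rw [Finset.card_filter, Nat.cast_sum]
    refine Finset.sum_congr rfl fun i _ => ?_
    simp [Set.indicator]
  have hmono := integral_mono (hsum I F) ((hint E hE).add ((hsum J G).add (hsum J' G'))) fun ω => by
    simp only [Pi.add_apply]
    rw [← hcard, ← hcard, ← hcard]
    have h1 : E.indicator (1 : Ω → ℝ) ω = ((if ω ∈ E then 1 else 0 : ℕ) : ℝ) := by
      simp [Set.indicator]
    rw [h1]
    exact_mod_cast h ω
  rwa [integral_add' (hint E hE) ((hsum J G).add (hsum J' G')),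
    integral_add' (hsum J G) (hsum J' G'), hval, hval, hval, integral_indicator_one hE] at hmono

theorem measureReal_le_sum_pow_card {ι : Type*} (hB : IsBinomialAttributeMatrix P B p)
    (I : Finset ι) (F : ι → Finset (Fin n × Fin m)) {E : Set Ω}
    (h : E ⊆ ⋃ i ∈ I, allOnes B (F i)) : P.real E ≤ ∑ i ∈ I, p ^ (F i).card := by
  refine (measureReal_mono h (measure_ne_top _ _)).trans
    ((measureReal_biUnion_finset_le _ _).trans_eq ?_)
  exact Finset.sum_congr rfl fun i _ => measureReal_allOnes hB _

theorem measureReal_starEvent_le (hB : IsBinomialAttributeMatrix P B p)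
    {c a b : Fin n} (hca : c ≠ a) (hcb : c ≠ b) (hab : a ≠ b) :
    P.real (starEvent B (c, a, b)) ≤ m * p ^ 3 + m ^ 2 * p ^ 4 := by
  have h : starEvent B (c, a, b) ⊆
      (⋃ k ∈ (Finset.univ : Finset (Fin m)), allOnes B {(c, k), (a, k), (b, k)}) ∪
      ⋃ x ∈ (Finset.univ : Finset (Fin m)).offDiag,
        allOnes B {(c, x.1), (a, x.1), (c, x.2), (b, x.2)} := by
    rintro ω ⟨⟨k, h1, h2⟩, ⟨l, h3, h4⟩⟩
    by_cases hkl : k = l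
    · subst hkl
      refine Or.inl (Set.mem_biUnion (Finset.mem_univ k) ?_)
      simp_all [allOnes]
    · refine Or.inr (Set.mem_biUnion (x := (k, l)) (by simpa using hkl) ?_)
      simp_all [allOnes]
  refine (measureReal_mono h (measure_ne_top _ _)).trans ((measureReal_union_le _ _).trans ?_)
  refine add_le_add ((measureReal_le_sum_pow_card hB _ _ subset_rfl).trans_eq ?_)
    ((measureReal_le_sum_pow_card hB _ _ subset_rfl).trans ?_)
  · simp [Finset.card_insert_of_notMem, hca, hcb, hab]
  · calc _ ≤ ∑ x ∈ (Finset.univ : Finset (Fin m)).offDiag, p ^ 4 := by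
          refine Finset.sum_le_sum fun x hx => ?_
          have hx : x.1 ≠ x.2 := by simpa using hx
          refine le_of_eq ?_
          simp [Finset.card_insert_of_notMem, hca, hcb, hab, hca.symm, hx]
      _ ≤ m ^ 2 * p ^ 4 := by
          rw [Finset.sum_const, nsmul_eq_mul]
          gcongr
          rw [Finset.offDiag_card, Finset.card_univ, Fintype.card_fin]
          exact_mod_cast (Nat.sub_le _ _).trans_eq (sq m).symm

/-- Let `X` and `Y` count the attributes that `c` shares with `a` and with `b`. Take expectations in
`X Y ≤ 1_{X, Y > 0} + X(X-1) Y + Y(Y-1) X`; the last two terms count the witnesses of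
`sum_witness_star_le`. -/
theorem le_measureReal_starEvent (hB : IsBinomialAttributeMatrix P B p) (hp : 0 ≤ p)
    (hp1 : p ≤ 1) {c a b : Fin n} (hca : c ≠ a) (hcb : c ≠ b) (hab : a ≠ b) :
    m * p ^ 3 + m ^ 2 * p ^ 4 - m * p ^ 4 - 2 * (2 * m ^ 2 * p ^ 5 + m ^ 3 * p ^ 6) ≤
      P.real (starEvent B (c, a, b)) := by
  classical
  have hnat : ∀ x y : ℕ, x * y ≤ (if 0 < x ∧ 0 < y then 1 else 0) +
      ((x * x - x) * y + (y * y - y) * x) := by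
    intro x y
    obtain hx | hx : x ≤ 1 ∨ 2 ≤ x := by omega
    · obtain hy | hy : y ≤ 1 ∨ 2 ≤ y := by omega
      · interval_cases x <;> interval_cases y <;> simp
      · have h : y ≤ y * y - y := Nat.le_sub_of_add_le (by nlinarith)
        rw [mul_comm x y]
        exact (Nat.mul_le_mul_right x h).trans
          ((Nat.le_add_left _ _).trans (Nat.le_add_left _ _))
    · have h : x ≤ x * x - x := Nat.le_sub_of_add_le (by nlinarith)
      exact (Nat.mul_le_mul_right y h).trans
        ((Nat.le_add_right _ _).trans (Nat.le_add_left _ _))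
  have key := sum_pow_card_le_of_card_le hB (Finset.univ : Finset (Fin m × Fin m))
    (fun x => {(c, x.1), (a, x.1), (c, x.2), (b, x.2)})
    ((Finset.univ : Finset (Fin m)).offDiag ×ˢ Finset.univ)
    ((Finset.univ : Finset (Fin m)).offDiag ×ˢ Finset.univ)
    (witness (c, a) (c, a) (c, b)) (witness (c, b) (c, b) (c, a))
    (measurableSet_starEvent hB (c, a, b)) (fun ω => by
      set K : Finset (Fin m) := Finset.univ.filter fun k => B c k ω = 1 ∧ B a k ω = 1 with hK
      set L : Finset (Fin m) := Finset.univ.filter fun k => B c k ω = 1 ∧ B b k ω = 1 with hL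
      convert hnat K.card L.card using 1
      · rw [← Finset.card_product]
        congr 1
        ext ⟨k, l⟩
        simp [allOnes, hK, hL]
        tauto
      · congr 1
        · refine if_congr ?_ rfl rfl
          simp [Finset.card_pos, Finset.Nonempty, hK, hL, starEvent, linked]
        · rw [← Finset.offDiag_card, ← Finset.offDiag_card, ← Finset.card_product,
            ← Finset.card_product]
          congr 2
          · ext ⟨⟨k, k'⟩, l⟩
            simp [allOnes, witness, hK, hL]
            tauto
          · ext ⟨⟨k, k'⟩, l⟩
            simp [allOnes, witness, hK, hL]
            tauto)
  -- On the diagonal the two positions in row `c` coincide, leaving three positions instead of four.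
  have h1 : ∑ x : Fin m × Fin m,
      p ^ ({(c, x.1), (a, x.1), (c, x.2), (b, x.2)} : Finset (Fin n × Fin m)).card =
      ∑ x : Fin m × Fin m, (p ^ 4 + if x.1 = x.2 then p ^ 3 - p ^ 4 else 0) := by
    refine Finset.sum_congr rfl fun x _ => ?_
    obtain ⟨k, l⟩ := x
    split_ifs with hkl
    · simp only at hkl
      subst hkl
      simp [Finset.card_insert_of_notMem, hca, hcb, hab, hca.symm]
    · simp only at hkl
      simp [Finset.card_insert_of_notMem, hca, hcb, hab, hca.symm, hkl]
  have h2 : ∑ x : Fin m × Fin m, (p ^ 4 + if x.1 = x.2 then p ^ 3 - p ^ 4 else 0) =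
      m ^ 2 * p ^ 4 + m * (p ^ 3 - p ^ 4) := by
    rw [Finset.sum_add_distrib, Fintype.sum_prod_type, Fintype.sum_prod_type]
    simp
    ring
  rw [h1, h2] at key
  have h3 := sum_witness_star_le (m := m) hp hp1 hca hcb hab
  have h4 := sum_witness_star_le (m := m) hp hp1 hcb hca hab.symm
  linarith

/-- If the attributes chosen for `ca` and `cb` coincide, all three nodes share it. Otherwise they
are distinct, and the third edge brings a witness of its own. -/
theorem measureReal_triangleEvent_le (hB : IsBinomialAttributeMatrix P B p) (hp : 0 ≤ p)
    (hp1 : p ≤ 1) {c a b : Fin n} (hca : c ≠ a) (hcb : c ≠ b) (hab : a ≠ b) :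
    P.real (triangleEvent B (c, a, b)) ≤
      m * p ^ 3 + (2 * m ^ 2 * p ^ 5 + m ^ 3 * p ^ 6) := by
  have h : triangleEvent B (c, a, b) ⊆
      (⋃ k ∈ (Finset.univ : Finset (Fin m)), allOnes B {(c, k), (a, k), (b, k)}) ∪
      ⋃ x ∈ (Finset.univ : Finset (Fin m)).offDiag ×ˢ Finset.univ,
        allOnes B (witness (c, a) (c, b) (a, b) x) := by
    rintro ω ⟨⟨⟨k, h1, h2⟩, ⟨l, h3, h4⟩⟩, ⟨j, h5, h6⟩⟩
    by_cases hkl : k = l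
    · subst hkl
      refine Or.inl (Set.mem_biUnion (Finset.mem_univ k) ?_)
      simp_all [allOnes]
    · refine Or.inr (Set.mem_biUnion (x := ((k, l), j)) (by simpa using hkl) ?_)
      simp_all [allOnes, witness]
  refine (measureReal_mono h (measure_ne_top _ _)).trans ((measureReal_union_le _ _).trans ?_)
  refine add_le_add ((measureReal_le_sum_pow_card hB _ _ subset_rfl).trans_eq ?_)
    ((measureReal_le_sum_pow_card hB _ _ subset_rfl).trans
      (sum_witness_triangle_le hp hp1 hca hcb hab))
  simp [Finset.card_insert_of_notMem, hca, hcb, hab]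

/-- With `X` the number of attributes common to all three nodes, take expectations in `X ≤ 1_{X > 0}
+ X(X-1)`. The second correction family of the Bonferroni lemma is empty here. -/
theorem le_measureReal_triangleEvent (hB : IsBinomialAttributeMatrix P B p)
    {c a b : Fin n} (hca : c ≠ a) (hcb : c ≠ b) (hab : a ≠ b) :
    m * p ^ 3 - m ^ 2 * p ^ 6 ≤ P.real (triangleEvent B (c, a, b)) := by
  classical
  have hnat : ∀ x : ℕ, x ≤ (if 0 < x then 1 else 0) + ((x * x - x) + 0) := by
    intro x
    obtain hx | hx : x ≤ 1 ∨ 2 ≤ x := by omega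
    · interval_cases x <;> simp
    · have h : x ≤ x * x - x := Nat.le_sub_of_add_le (by nlinarith)
      omega
  have key := sum_pow_card_le_of_card_le hB (Finset.univ : Finset (Fin m))
    (fun k => {(c, k), (a, k), (b, k)}) (Finset.univ : Finset (Fin m)).offDiag ∅
    (fun x => {(c, x.1), (a, x.1), (b, x.1), (c, x.2), (a, x.2), (b, x.2)}) (fun _ => ∅)
    (measurableSet_triangleEvent hB (c, a, b)) (fun ω => by
      set K : Finset (Fin m) :=
        Finset.univ.filter fun k => B c k ω = 1 ∧ B a k ω = 1 ∧ B b k ω = 1 with hK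
      have hpos : 0 < K.card → ω ∈ triangleEvent B (c, a, b) := by
        intro h
        obtain ⟨k, hk⟩ := Finset.card_pos.1 h
        obtain ⟨h1, h2, h3⟩ := (Finset.mem_filter.1 hk).2
        exact ⟨⟨⟨k, h1, h2⟩, ⟨k, h1, h3⟩⟩, ⟨k, h2, h3⟩⟩
      have e1 : (Finset.univ.filter fun k =>
          ω ∈ allOnes B {(c, k), (a, k), (b, k)}) = K := by
        ext k
        simp [allOnes, hK]
      have e2 : ((Finset.univ : Finset (Fin m)).offDiag.filter fun x => ω ∈ allOnes B
          {(c, x.1), (a, x.1), (b, x.1), (c, x.2), (a, x.2), (b, x.2)}) = K.offDiag := by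
        ext ⟨k, l⟩
        simp [allOnes, hK]
        tauto
      rw [e1, e2, Finset.offDiag_card]
      refine (hnat K.card).trans ?_
      gcongr
      · split_ifs with h1 h2 h2
        · exact le_rfl
        · exact absurd (hpos h1) h2
        · exact Nat.zero_le _
        · exact le_rfl
      · exact Nat.zero_le _)
  have h1 : ∑ k : Fin m, p ^ ({(c, k), (a, k), (b, k)} : Finset (Fin n × Fin m)).card =
      m * p ^ 3 := by
    simp [Finset.card_insert_of_notMem, hca, hcb, hab]
  have h2 : ∑ x ∈ (Finset.univ : Finset (Fin m)).offDiag,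
      p ^ ({(c, x.1), (a, x.1), (b, x.1), (c, x.2), (a, x.2), (b, x.2)} :
        Finset (Fin n × Fin m)).card ≤ m ^ 2 * p ^ 6 := by
    calc _ ≤ ∑ x ∈ (Finset.univ : Finset (Fin m)).offDiag, p ^ 6 := by
          refine Finset.sum_le_sum fun x hx => ?_
          have hx : x.1 ≠ x.2 := by simpa using hx
          refine le_of_eq ?_
          simp [Finset.card_insert_of_notMem, hca, hcb, hab, hca.symm, hcb.symm, hab.symm, hx]
      _ ≤ m ^ 2 * p ^ 6 := by
          rw [Finset.sum_const, nsmul_eq_mul]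
          gcongr
          rw [Finset.offDiag_card, Finset.card_univ, Fintype.card_fin]
          exact_mod_cast (Nat.sub_le _ _).trans_eq (sq m).symm
  rw [h1, Finset.sum_empty] at key
  linarith

end FirstMoment

/-! ### Limits in the balanced sparse regime, uniformly over node sets of a given size. -/

section Asymptotics

variable {lam mu : ℝ} {n m : ℕ → ℕ} {p : ℕ → ℝ}

theorem IsBalancedSparse.tendsto_cast (h : IsBalancedSparse lam mu n m p) :
    Tendsto (fun ν => (n ν : ℝ)) atTop atTop :=
  tendsto_natCast_atTop_atTop.comp h.tendsto_n

theorem IsBalancedSparse.tendsto_n_mul_p (h : IsBalancedSparse lam mu n m p) :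
    Tendsto (fun ν => (n ν : ℝ) * p ν) atTop (𝓝 (lam / mu)) := by
  have h1 : (fun ν => (n ν : ℝ) * p ν) ~[atTop] fun _ => lam / mu := by
    refine ((IsEquivalent.refl (u := fun ν => (n ν : ℝ))).mul h.equiv_p).congr_right ?_
    filter_upwards [h.tendsto_cast.eventually_gt_atTop 0] with ν hν
    simp only [Pi.mul_apply]
    field_simp
  exact h1.symm.tendsto_nhds tendsto_const_nhds

theorem IsBalancedSparse.tendsto_m_mul_p (h : IsBalancedSparse lam mu n m p) (hlam : 0 < lam)
    (hmu : 0 < mu) : Tendsto (fun ν => (m ν : ℝ) * p ν) atTop (𝓝 mu) := by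
  have h1 : (fun ν => (m ν : ℝ) * p ν) ~[atTop] fun _ => mu := by
    refine (h.equiv_m.mul h.equiv_p).congr_right ?_
    filter_upwards [h.tendsto_cast.eventually_gt_atTop 0] with ν hν
    simp only [Pi.mul_apply]
    field_simp
  exact h1.symm.tendsto_nhds tendsto_const_nhds

theorem IsBalancedSparse.tendsto_p (h : IsBalancedSparse lam mu n m p) :
    Tendsto p atTop (𝓝 0) := by
  have h1 := h.tendsto_n_mul_p.mul h.tendsto_cast.inv_tendsto_atTop
  rw [mul_zero] at h1
  refine h1.congr' ?_
  filter_upwards [h.tendsto_cast.eventually_gt_atTop 0] with ν hν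
  simp only [Pi.inv_apply]
  field_simp

theorem IsBalancedSparse.eventually_p_mem (h : IsBalancedSparse lam mu n m p) (hlam : 0 < lam)
    (hmu : 0 < mu) : ∀ᶠ ν in atTop, 0 < p ν ∧ p ν ≤ 1 := by
  filter_upwards [h.tendsto_cast.eventually_gt_atTop 0,
    h.tendsto_n_mul_p.eventually_const_lt (div_pos hlam hmu),
    h.tendsto_p.eventually_le_const zero_lt_one] with ν h1 h2 h3
  exact ⟨pos_of_mul_pos_right h2 h1.le, h3⟩

/-- The bound is written as `s.card ^ 3 / N ^ 2` times a factor that converges in the regime; `1 - 3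
/ s.card` pays for the triples with repetitions. -/
theorem le_sum_distinctTriples {V : Type*} [DecidableEq V] (s : Finset V)
    {f : V × V × V → ℝ} {N lo : ℝ} (hN : 0 < N) (hs : 0 < s.card) (hlo : 0 ≤ lo)
    (h : ∀ t ∈ distinctTriples s, lo ≤ f t) :
    (s.card : ℝ) ^ 3 / N ^ 2 * (N ^ 2 * lo * (1 - 3 / s.card)) ≤ ∑ t ∈ distinctTriples s, f t := by
  have hs' : (0 : ℝ) < s.card := by exact_mod_cast hs
  have hc : (s.card : ℝ) ^ 3 ≤ (distinctTriples s).card + 3 * (s.card : ℝ) ^ 2 := by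
    exact_mod_cast card_pow_three_le s
  calc (s.card : ℝ) ^ 3 / N ^ 2 * (N ^ 2 * lo * (1 - 3 / s.card))
      = ((s.card : ℝ) ^ 3 - 3 * (s.card : ℝ) ^ 2) * lo := by field_simp
    _ ≤ (distinctTriples s).card * lo := by gcongr; linarith
    _ ≤ _ := by
      rw [← nsmul_eq_mul]
      exact Finset.card_nsmul_le_sum _ _ _ h

theorem sum_distinctTriples_le {V : Type*} [DecidableEq V] (s : Finset V)
    {f : V × V × V → ℝ} {N hi : ℝ} (hN : 0 < N) (hhi : 0 ≤ hi)
    (h : ∀ t ∈ distinctTriples s, f t ≤ hi) :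
    ∑ t ∈ distinctTriples s, f t ≤ (s.card : ℝ) ^ 3 / N ^ 2 * (N ^ 2 * hi) := by
  calc _ ≤ (distinctTriples s).card * hi := by
        rw [← nsmul_eq_mul]
        exact Finset.sum_le_card_nsmul _ _ _ h
    _ ≤ (s.card : ℝ) ^ 3 * hi := by
        gcongr
        exact_mod_cast card_distinctTriples_le s
    _ = _ := by field_simp

/-- If the terms are uniformly asymptotic to `c / n ^ 2`, their sums over distinct triples of a
set of size `n₀` are uniformly asymptotic to `c * n₀ ^ 3 / n ^ 2`. -/
theorem eventually_abs_sum_distinctTriples_sub_le {c : ℝ} (hc : 0 < c)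
    (hn : Tendsto (fun ν => (n ν : ℝ)) atTop atTop) {n₀ : ℕ → ℕ} (hn₀ : Tendsto n₀ atTop atTop)
    (f : ∀ ν, Fin (n ν) × Fin (n ν) × Fin (n ν) → ℝ) {lo hi : ℕ → ℝ}
    (hlo : Tendsto (fun ν => (n ν : ℝ) ^ 2 * lo ν) atTop (𝓝 c))
    (hhi : Tendsto (fun ν => (n ν : ℝ) ^ 2 * hi ν) atTop (𝓝 c))
    (hf : ∀ᶠ ν in atTop, ∀ s, ∀ t ∈ distinctTriples s, lo ν ≤ f ν t ∧ f ν t ≤ hi ν)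
    {ε : ℝ} (hε : 0 < ε) :
    ∀ᶠ ν in atTop, ∀ s : Finset (Fin (n ν)), s.card = n₀ ν →
      |∑ t ∈ distinctTriples s, f ν t - c * ((n₀ ν : ℝ) ^ 3 / (n ν : ℝ) ^ 2)| ≤
        ε * ((n₀ ν : ℝ) ^ 3 / (n ν : ℝ) ^ 2) := by
  have hlo' : Tendsto (fun ν => (n ν : ℝ) ^ 2 * lo ν * (1 - 3 / (n₀ ν : ℝ))) atTop (𝓝 c) := by
    have h3 : Tendsto (fun ν => 3 / (n₀ ν : ℝ)) atTop (𝓝 0) :=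
      (tendsto_natCast_atTop_atTop.comp hn₀).const_div_atTop 3
    simpa using hlo.mul ((tendsto_const_nhds (x := (1 : ℝ))).sub h3)
  filter_upwards [hf, hn.eventually_gt_atTop 0, hn₀.eventually_gt_atTop 0,
    hlo.eventually_const_lt hc, hhi.eventually_const_lt hc,
    hlo'.eventually_const_le (sub_lt_self c hε), hhi.eventually_le_const (lt_add_of_pos_right c hε)]
    with ν h1 h2 h3 h4 h5 h6 h7 s hs
  have hlo0 : 0 ≤ lo ν := (pos_of_mul_pos_right h4 (sq_nonneg _)).le
  have hhi0 : 0 ≤ hi ν := (pos_of_mul_pos_right h5 (sq_nonneg _)).le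
  have k1 := le_sum_distinctTriples s h2 (hs ▸ h3) hlo0 fun t ht => (h1 s t ht).1
  have k2 := sum_distinctTriples_le s h2 hhi0 fun t ht => (h1 s t ht).2
  rw [hs] at k1 k2
  set r := (n₀ ν : ℝ) ^ 3 / (n ν : ℝ) ^ 2 with hr
  have hr0 : 0 ≤ r := by positivity
  rw [abs_le]
  constructor
  · nlinarith [mul_le_mul_of_nonneg_left h6 hr0]
  · nlinarith [mul_le_mul_of_nonneg_left h7 hr0]

/-- Each expression is `(n p)²` times a polynomial in `m p` and a power of `p`; any leftover factor
`p` sends it to zero. -/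
theorem tendsto_sq_mul_errors (h : IsBalancedSparse lam mu n m p) (hlam : 0 < lam)
    (hmu : 0 < mu) :
    Tendsto (fun ν => (n ν : ℝ) ^ 2 * (m ν * p ν ^ 3)) atTop (𝓝 (lam ^ 2 / mu)) ∧
    Tendsto (fun ν => (n ν : ℝ) ^ 2 * (m ν ^ 2 * p ν ^ 4)) atTop (𝓝 (lam ^ 2)) ∧
    Tendsto (fun ν => (n ν : ℝ) ^ 2 * (m ν * p ν ^ 4)) atTop (𝓝 0) ∧
    Tendsto (fun ν => (n ν : ℝ) ^ 2 * (2 * m ν ^ 2 * p ν ^ 5 + m ν ^ 3 * p ν ^ 6)) atTop (𝓝 0) ∧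
    Tendsto (fun ν => (n ν : ℝ) ^ 2 * (m ν ^ 2 * p ν ^ 6)) atTop (𝓝 0) := by
  have hx := h.tendsto_n_mul_p
  have hy := h.tendsto_m_mul_p hlam hmu
  have hp := h.tendsto_p
  refine ⟨?_, ?_, ?_, ?_, ?_⟩
  · convert (hx.pow 2).mul hy using 2
    · ring
    · field_simp
  · convert (hx.pow 2).mul (hy.pow 2) using 2
    · ring
    · field_simp
  · convert ((hx.pow 2).mul hy).mul hp using 2
    · ring
    · simp
  · convert ((hx.pow 2).mul (((hy.pow 2).const_mul 2).add (hy.pow 3))).mul hp using 2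
    · ring
    · simp
  · convert ((hx.pow 2).mul (hy.pow 2)).mul (hp.pow 2) using 2
    · ring
    · simp

variable {Ω : ℕ → Type*} [∀ ν, MeasurableSpace (Ω ν)] {P : ∀ ν, Measure (Ω ν)}
  [∀ ν, IsProbabilityMeasure (P ν)] {B : ∀ ν, Fin (n ν) → Fin (m ν) → Ω ν → ℕ}

theorem eventually_abs_sum_starEvent_sub_le (h : IsBalancedSparse lam mu n m p) (hlam : 0 < lam)
    (hmu : 0 < mu) (hB : ∀ ν, IsBinomialAttributeMatrix (P ν) (B ν) (p ν)) {n₀ : ℕ → ℕ}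
    (hn₀ : Tendsto n₀ atTop atTop) {ε : ℝ} (hε : 0 < ε) :
    ∀ᶠ ν in atTop, ∀ s : Finset (Fin (n ν)), s.card = n₀ ν →
      |∑ t ∈ distinctTriples s, (P ν).real (starEvent (B ν) t) -
        (lam ^ 2 / mu + lam ^ 2) * ((n₀ ν : ℝ) ^ 3 / (n ν : ℝ) ^ 2)| ≤
        ε * ((n₀ ν : ℝ) ^ 3 / (n ν : ℝ) ^ 2) := by
  obtain ⟨e1, e2, e3, e4, -⟩ := tendsto_sq_mul_errors h hlam hmu
  refine eventually_abs_sum_distinctTriples_sub_le (by positivity) h.tendsto_cast hn₀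
    (fun ν t => (P ν).real (starEvent (B ν) t))
    (lo := fun ν => m ν * p ν ^ 3 + m ν ^ 2 * p ν ^ 4 - m ν * p ν ^ 4 -
      2 * (2 * m ν ^ 2 * p ν ^ 5 + m ν ^ 3 * p ν ^ 6))
    (hi := fun ν => m ν * p ν ^ 3 + m ν ^ 2 * p ν ^ 4) ?_ ?_ ?_ hε
  · convert ((e1.add e2).sub e3).sub (e4.const_mul 2) using 2
    · ring
    · simp
  · convert e1.add e2 using 2
    ring
  · filter_upwards [h.eventually_p_mem hlam hmu] with ν hp s t ht
    obtain ⟨-, h1, h2, h3⟩ := Finset.mem_filter.1 ht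
    exact ⟨le_measureReal_starEvent (hB ν) hp.1.le hp.2 h1 h2 h3,
      measureReal_starEvent_le (hB ν) h1 h2 h3⟩

theorem eventually_abs_sum_triangleEvent_sub_le (h : IsBalancedSparse lam mu n m p)
    (hlam : 0 < lam) (hmu : 0 < mu) (hB : ∀ ν, IsBinomialAttributeMatrix (P ν) (B ν) (p ν))
    {n₀ : ℕ → ℕ} (hn₀ : Tendsto n₀ atTop atTop) {ε : ℝ} (hε : 0 < ε) :
    ∀ᶠ ν in atTop, ∀ s : Finset (Fin (n ν)), s.card = n₀ ν →
      |∑ t ∈ distinctTriples s, (P ν).real (triangleEvent (B ν) t) -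
        lam ^ 2 / mu * ((n₀ ν : ℝ) ^ 3 / (n ν : ℝ) ^ 2)| ≤
        ε * ((n₀ ν : ℝ) ^ 3 / (n ν : ℝ) ^ 2) := by
  obtain ⟨e1, -, -, e4, e5⟩ := tendsto_sq_mul_errors h hlam hmu
  refine eventually_abs_sum_distinctTriples_sub_le (by positivity) h.tendsto_cast hn₀
    (fun ν t => (P ν).real (triangleEvent (B ν) t))
    (lo := fun ν => m ν * p ν ^ 3 - m ν ^ 2 * p ν ^ 6)
    (hi := fun ν => m ν * p ν ^ 3 + (2 * m ν ^ 2 * p ν ^ 5 + m ν ^ 3 * p ν ^ 6)) ?_ ?_ ?_ hε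
  · convert e1.sub e5 using 2
    · ring
    · simp
  · convert e1.add e4 using 2
    · ring
    · simp
  · filter_upwards [h.eventually_p_mem hlam hmu] with ν hp s t ht
    obtain ⟨-, h1, h2, h3⟩ := Finset.mem_filter.1 ht
    exact ⟨le_measureReal_triangleEvent (hB ν) h1 h2 h3,
      measureReal_triangleEvent_le (hB ν) hp.1.le hp.2 h1 h2 h3⟩

theorem chebyshev_bound_le {k N p u r δ : ℝ} (hk : 0 ≤ k) (hkN : k ≤ N) (hp : 0 ≤ p)
    (hu : 0 ≤ u) (hr : 0 < r) (hδ : 0 < δ) :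
    r * N ^ 2 * ((p * u) ^ 2 * (9 * (3 + k * (p * u)) ^ 2)) / (δ / 2 * r) ^ 2 ≤
      (N * p * u) ^ 2 * (9 * (3 + N * p * u) ^ 2) * (4 / δ ^ 2) / r := by
  calc _ ≤ r * N ^ 2 * ((p * u) ^ 2 * (9 * (3 + N * (p * u)) ^ 2)) / (δ / 2 * r) ^ 2 := by gcongr
    _ = _ := by field_simp; ring

/-- Concentration, uniformly over sets of size `n₀`, from Chebyshev bounds. -/
theorem eventually_measureReal_le_of_chebyshev (h : IsBalancedSparse lam mu n m p)
    (hlam : 0 < lam) (hmu : 0 < mu) {n₀ : ℕ → ℕ}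
    (hr : Tendsto (fun ν => (n₀ ν : ℝ) ^ 3 / (n ν : ℝ) ^ 2) atTop atTop)
    (X : ∀ ν, Finset (Fin (n ν)) → Ω ν → ℝ) (M : ∀ ν, Finset (Fin (n ν)) → ℝ) {c : ℝ}
    (hM : ∀ ε : ℝ, 0 < ε → ∀ᶠ ν in atTop, ∀ s : Finset (Fin (n ν)), s.card = n₀ ν →
      |M ν s - c * ((n₀ ν : ℝ) ^ 3 / (n ν : ℝ) ^ 2)| ≤ ε * ((n₀ ν : ℝ) ^ 3 / (n ν : ℝ) ^ 2))
    (hX : ∀ᶠ ν in atTop, ∀ s : Finset (Fin (n ν)), ∀ δ : ℝ, 0 < δ →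
      (P ν).real {ω | δ ≤ |X ν s ω - M ν s|} ≤ s.card ^ 3 * ((p ν * (8 + m ν * p ν)) ^ 2 *
        (9 * (3 + s.card * (p ν * (8 + m ν * p ν))) ^ 2)) / δ ^ 2)
    {δ ε : ℝ} (hδ : 0 < δ) (hε : 0 < ε) :
    ∀ᶠ ν in atTop, ∀ s : Finset (Fin (n ν)), s.card = n₀ ν →
      (P ν).real {ω | δ * ((n₀ ν : ℝ) ^ 3 / (n ν : ℝ) ^ 2) ≤
        |X ν s ω - c * ((n₀ ν : ℝ) ^ 3 / (n ν : ℝ) ^ 2)|} ≤ ε := by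
  set r : ℕ → ℝ := fun ν => (n₀ ν : ℝ) ^ 3 / (n ν : ℝ) ^ 2 with hr_def
  have hq : Tendsto (fun ν => (n ν : ℝ) * p ν * (8 + m ν * p ν)) atTop
      (𝓝 (lam / mu * (8 + mu))) :=
    h.tendsto_n_mul_p.mul (tendsto_const_nhds.add (h.tendsto_m_mul_p hlam hmu))
  have hw : Tendsto (fun ν => ((n ν : ℝ) * p ν * (8 + m ν * p ν)) ^ 2 *
      (9 * (3 + (n ν : ℝ) * p ν * (8 + m ν * p ν)) ^ 2) * (4 / δ ^ 2) / r ν) atTop (𝓝 0) :=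
    (((hq.pow 2).mul (((tendsto_const_nhds.add hq).pow 2).const_mul 9)).mul_const _).div_atTop hr
  -- Half of `δ` absorbs the error in the mean, the other half the fluctuation around it.
  filter_upwards [hM (δ / 2) (by positivity), hX, hr.eventually_gt_atTop 0,
    hw.eventually_le_const hε, h.eventually_p_mem hlam hmu, h.tendsto_cast.eventually_gt_atTop 0]
    with ν h1 h2 h3 h4 h5 h6 s hs
  change 0 < r ν at h3
  have h1s : |M ν s - c * r ν| ≤ δ / 2 * r ν := h1 s hs
  change (P ν).real {ω | δ * r ν ≤ |X ν s ω - c * r ν|} ≤ ε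
  have hp := h5.1
  have hle : (s.card : ℝ) ≤ n ν := by
    exact_mod_cast (Finset.card_le_univ s).trans_eq (Fintype.card_fin _)
  refine (measureReal_mono (fun ω hω => ?_) (measure_ne_top _ _)).trans
    ((h2 s (δ / 2 * r ν) (by positivity)).trans (le_trans ?_ h4))
  · have hω : δ * r ν ≤ |X ν s ω - c * r ν| := hω
    have := abs_sub_le (X ν s ω) (M ν s) (c * r ν)
    change δ / 2 * r ν ≤ _
    linarith
  · have hrn : (s.card : ℝ) ^ 3 = r ν * (n ν : ℝ) ^ 2 := by
      rw [hs, div_mul_cancel₀ _ (by positivity)]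
    rw [hrn]
    exact chebyshev_bound_le (Nat.cast_nonneg _) hle hp.le (by positivity) h3 hδ

/-- A random choice of nodes which is independent of the graph can be treated as deterministic. -/
theorem measureReal_le_of_indepFun {Ω α β : Type*} [MeasurableSpace Ω] {P : Measure Ω}
    [IsProbabilityMeasure P] [Fintype α] [MeasurableSpace α] [MeasurableSingletonClass α]
    [MeasurableSpace β] [DiscreteMeasurableSpace β] {S : Ω → α} {G : Ω → β} (hS : Measurable S)
    (hSG : IndepFun S G P) (bad : α → Set β) {ε : ℝ} (hε : ∀ ω, P.real (G ⁻¹' bad (S ω)) ≤ ε) :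
    P.real {ω | G ω ∈ bad (S ω)} ≤ ε := by
  have hsub : {ω | G ω ∈ bad (S ω)} ⊆ ⋃ a : α, S ⁻¹' {a} ∩ G ⁻¹' bad a := fun ω hω =>
    Set.mem_iUnion.2 ⟨S ω, rfl, hω⟩
  calc P.real {ω | G ω ∈ bad (S ω)} ≤ P.real (⋃ a : α, S ⁻¹' {a} ∩ G ⁻¹' bad a) :=
        measureReal_mono hsub (measure_ne_top _ _)
    _ ≤ ∑ a : α, P.real (S ⁻¹' {a} ∩ G ⁻¹' bad a) := measureReal_iUnion_fintype_le _
    _ ≤ ∑ a : α, P.real (S ⁻¹' {a}) * ε := by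
        refine Finset.sum_le_sum fun a _ => ?_
        have hmul : P.real (S ⁻¹' {a} ∩ G ⁻¹' bad a) =
            P.real (S ⁻¹' {a}) * P.real (G ⁻¹' bad a) := by
          simp only [measureReal_def, ← ENNReal.toReal_mul]
          rw [hSG.measure_inter_preimage_eq_mul _ _ (measurableSet_singleton a)
            (MeasurableSet.of_discrete)]
        rw [hmul]
        -- The bound `ε` is available only at values that `S` attains; at any other value the
        -- preimage is empty.
        rcases (S ⁻¹' {a}).eq_empty_or_nonempty with h0 | ⟨ω, hω⟩
        · simp [h0]
        · obtain rfl : S ω = a := hω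
          exact mul_le_mul_of_nonneg_left (hε ω) measureReal_nonneg
    _ = ε := by
        rw [← Finset.sum_mul, sum_measureReal_preimage_singleton _
          fun a _ => hS (measurableSet_singleton a)]
        simp

/-- Singletons are pulled back from singleton relations, and a finite node set carries finitely many
graphs. Every set of bad graphs is therefore measurable. -/
instance {V : Type*} [Finite V] : DiscreteMeasurableSpace (SimpleGraph V) := by
  have : Countable (SimpleGraph V) := Finite.to_countable
  have : MeasurableSingletonClass (SimpleGraph V) := by
    refine ⟨fun G => ⟨{G.Adj}, measurableSet_singleton _, ?_⟩⟩
    ext H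
    exact SimpleGraph.adj_inj
  infer_instance

end Asymptotics

/-! ### Concentration of the quotient, and the model coefficient. -/

section Transitivity

/-- Continuity of the quotient `y / x` at a point, in scaled form. -/
theorem exists_pos_forall_abs_div_sub_le {a b ε : ℝ} (ha : 0 < a) (hε : 0 < ε) :
    ∃ δ > 0, ∀ r x y : ℝ, 0 < r → |x - a * r| < δ * r → |y - b * r| < δ * r →
      0 < x ∧ |y / x - b / a| ≤ ε := by
  have hcont : ContinuousAt (fun z : ℝ × ℝ => z.2 / z.1) (a, b) :=
    continuousAt_snd.div continuousAt_fst ha.ne'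
  obtain ⟨δ, hδ, h⟩ := Metric.continuousAt_iff.1 hcont ε hε
  -- The radius `δ` controls the quotient; the bound by `a` forces `x / r > 0`.
  refine ⟨min δ a, lt_min hδ ha, fun r x y hr hx hy => ?_⟩
  have hscale : ∀ z c : ℝ, |z - c * r| < min δ a * r → |z / r - c| < min δ a := by
    intro z c hz
    have : z / r - c = (z - c * r) / r := by field_simp
    rwa [this, abs_div, abs_of_pos hr, div_lt_iff₀ hr]
  have hx' := hscale x a hx
  have hy' := hscale y b hy
  have hxpos : 0 < x / r := by
    have := (abs_lt.1 (hx'.trans_le (min_le_right _ _))).1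
    linarith
  have hdist : dist (x / r, y / r) (a, b) < δ := by
    rw [Prod.dist_eq, Real.dist_eq, Real.dist_eq]
    exact max_lt (hx'.trans_le (min_le_left _ _)) (hy'.trans_le (min_le_left _ _))
  have hd := h hdist
  rw [Real.dist_eq] at hd
  simp only [div_div_div_cancel_right₀ hr.ne'] at hd
  exact ⟨by simpa [hr] using (div_pos_iff_of_pos_right hr).1 hxpos, hd.le⟩

/-- The graphs whose induced subgraph on `s` has no 2-star or has a transitivity coefficient
which is not within `ε` of `1 / (1 + mu)`. -/
def atypical {V : Type*} [DecidableEq V] (mu ε : ℝ) (s : Finset V) : Set (SimpleGraph V) :=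
  {H | ¬ (0 < orderedStars H s ∧
    |(orderedTriangles H s : ℝ) / orderedStars H s - 1 / (1 + mu)| ≤ ε)}

variable {lam mu : ℝ} {n m : ℕ → ℕ} {p : ℕ → ℝ}
  {Ω : ℕ → Type*} [∀ ν, MeasurableSpace (Ω ν)] {P : ∀ ν, Measure (Ω ν)}
  [∀ ν, IsProbabilityMeasure (P ν)] {B : ∀ ν, Fin (n ν) → Fin (m ν) → Ω ν → ℕ}

theorem limit_ratio (hlam : 0 < lam) (hmu : 0 < mu) :
    lam ^ 2 / mu / (lam ^ 2 / mu + lam ^ 2) = 1 / (1 + mu) := by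
  field_simp

theorem eventually_measureReal_atypical_le (h : IsBalancedSparse lam mu n m p) (hlam : 0 < lam)
    (hmu : 0 < mu) (hB : ∀ ν, IsBinomialAttributeMatrix (P ν) (B ν) (p ν)) {n₀ : ℕ → ℕ}
    (hn₀ : Tendsto n₀ atTop atTop)
    (hr : Tendsto (fun ν => (n₀ ν : ℝ) ^ 3 / (n ν : ℝ) ^ 2) atTop atTop) {ε η : ℝ} (hε : 0 < ε)
    (hη : 0 < η) :
    ∀ᶠ ν in atTop, ∀ s : Finset (Fin (n ν)), s.card = n₀ ν →
      (P ν).real (randomIntersectionGraph (B ν) ⁻¹' atypical mu ε s) ≤ η := by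
  have hcS : 0 < lam ^ 2 / mu + lam ^ 2 := by positivity
  obtain ⟨δ, hδ, hdiv⟩ := exists_pos_forall_abs_div_sub_le (b := lam ^ 2 / mu) hcS hε
  have hS := eventually_measureReal_le_of_chebyshev (P := P) h hlam hmu hr
    (fun ν s ω => (orderedStars (randomIntersectionGraph (B ν) ω) s : ℝ))
    (fun ν s => ∑ t ∈ distinctTriples s, (P ν).real (starEvent (B ν) t))
    (fun ε hε => eventually_abs_sum_starEvent_sub_le h hlam hmu hB hn₀ hε)
    ((h.eventually_p_mem hlam hmu).mono fun ν hp s δ hδ =>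
      measureReal_abs_orderedStars_sub_ge_le (hB ν) hp.1.le s hδ) hδ (half_pos hη)
  have hT := eventually_measureReal_le_of_chebyshev (P := P) h hlam hmu hr
    (fun ν s ω => (orderedTriangles (randomIntersectionGraph (B ν) ω) s : ℝ))
    (fun ν s => ∑ t ∈ distinctTriples s, (P ν).real (triangleEvent (B ν) t))
    (fun ε hε => eventually_abs_sum_triangleEvent_sub_le h hlam hmu hB hn₀ hε)
    ((h.eventually_p_mem hlam hmu).mono fun ν hp s δ hδ =>
      measureReal_abs_orderedTriangles_sub_ge_le (hB ν) hp.1.le s hδ) hδ (half_pos hη)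
  filter_upwards [hS, hT, hr.eventually_gt_atTop 0] with ν h1 h2 h3 s hs
  refine (measureReal_mono (fun ω hω => ?_) (measure_ne_top _ _)).trans
    ((measureReal_union_le _ _).trans ((add_le_add (h1 s hs) (h2 s hs)).trans_eq (add_halves η)))
  by_contra hcon
  rw [Set.mem_union, not_or] at hcon
  obtain ⟨k1, k2⟩ := hdiv _ _ _ h3 (not_le.1 hcon.1) (not_le.1 hcon.2)
  rw [limit_ratio hlam hmu] at k2
  exact hω ⟨by exact_mod_cast k1, k2⟩

theorem tendsto_measure_zero_of_eventually_le {A : ∀ ν, Set (Ω ν)}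
    (h : ∀ η : ℝ, 0 < η → ∀ᶠ ν in atTop, (P ν).real (A ν) ≤ η) :
    Tendsto (fun ν => P ν (A ν)) atTop (𝓝 0) := by
  have hreal : Tendsto (fun ν => (P ν).real (A ν)) atTop (𝓝 0) := by
    refine tendsto_order.2 ⟨fun a ha => Eventually.of_forall fun ν =>
      ha.trans_le measureReal_nonneg, fun a ha => ?_⟩
    filter_upwards [h (a / 2) (half_pos ha)] with ν hν
    exact hν.trans_lt (half_lt_self ha)
  have := ENNReal.tendsto_ofReal hreal
  rw [ENNReal.ofReal_zero] at this
  exact this.congr fun ν => ofReal_measureReal (measure_ne_top _ _)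

/-- Concentration of the transitivity coefficient on a random set of nodes. -/
theorem tendsto_measure_atypical (h : IsBalancedSparse lam mu n m p) (hlam : 0 < lam)
    (hmu : 0 < mu) (hB : ∀ ν, IsBinomialAttributeMatrix (P ν) (B ν) (p ν)) {n₀ : ℕ → ℕ}
    {S : ∀ ν, Ω ν → Finset (Fin (n ν))} (hS : ∀ ν, Measurable (S ν))
    (hcard : ∀ ν ω, (S ν ω).card = n₀ ν)
    (hind : ∀ ν, IndepFun (S ν) (randomIntersectionGraph (B ν)) (P ν))
    (ho : (fun ν => (n ν : ℝ) ^ (2 / 3 : ℝ)) =o[atTop] fun ν => (n₀ ν : ℝ)) {ε : ℝ}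
    (hε : 0 < ε) :
    Tendsto (fun ν => P ν {ω | randomIntersectionGraph (B ν) ω ∈ atypical mu ε (S ν ω)}) atTop
      (𝓝 0) := by
  have hpow : Tendsto (fun ν => (n ν : ℝ) ^ (2 / 3 : ℝ)) atTop atTop :=
    (tendsto_rpow_atTop (by norm_num)).comp h.tendsto_cast
  have hn₀ : Tendsto n₀ atTop atTop := by
    rw [← tendsto_natCast_atTop_iff (R := ℝ)]
    refine tendsto_atTop_mono' _ ?_ hpow
    filter_upwards [ho.bound one_pos] with ν hν
    simpa [abs_of_nonneg (Real.rpow_nonneg (Nat.cast_nonneg (n ν)) _)] using hν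
  -- Here the exponent 2/3 enters: `n₀³/n²` is the inverse of the cube of `n^(2/3)/n₀`.
  have hr : Tendsto (fun ν => (n₀ ν : ℝ) ^ 3 / (n ν : ℝ) ^ 2) atTop atTop := by
    have h0 : Tendsto (fun ν => ((n ν : ℝ) ^ (2 / 3 : ℝ) / n₀ ν) ^ 3) atTop (𝓝 0) := by
      simpa using ho.tendsto_div_nhds_zero.pow 3
    have hpos : ∀ᶠ ν in atTop, 0 < ((n ν : ℝ) ^ (2 / 3 : ℝ) / n₀ ν) ^ 3 := by
      filter_upwards [h.tendsto_cast.eventually_gt_atTop 0, hn₀.eventually_gt_atTop 0] with ν h1 h2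
      have : (0 : ℝ) < n₀ ν := by exact_mod_cast h2
      positivity
    refine (Tendsto.inv_tendsto_nhdsGT_zero
      (tendsto_nhdsWithin_iff.2 ⟨h0, hpos⟩)).congr fun ν => ?_
    rw [Pi.inv_apply, div_pow, inv_div, ← Real.rpow_natCast ((n ν : ℝ) ^ (2 / 3 : ℝ)),
      ← Real.rpow_mul (Nat.cast_nonneg _), ← Real.rpow_natCast (n ν : ℝ) 2]
    norm_num
  refine tendsto_measure_zero_of_eventually_le fun η hη => ?_
  filter_upwards [eventually_measureReal_atypical_le h hlam hmu hB hn₀ hr hε hη] with ν hν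
  exact measureReal_le_of_indepFun (hS ν) (hind ν) (atypical mu ε) fun ω => hν _ (hcard ν ω)

theorem integral_numTwoStars {Ω : Type*} [MeasurableSpace Ω]
    {P : Measure Ω} [IsProbabilityMeasure P] {n m : ℕ} {B : Fin n → Fin m → Ω → ℕ} {p : ℝ}
    (hB : IsBinomialAttributeMatrix P B p) :
    2 * ∫ ω, (numTwoStars (randomIntersectionGraph B ω) : ℝ) ∂P =
      ∑ t ∈ distinctTriples Finset.univ, P.real (starEvent B t) := by
  rw [← integral_orderedStars hB, ← integral_const_mul]
  refine integral_congr_ae (ae_of_all _ fun ω => ?_)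
  simp only [← two_mul_numTwoStars]
  push_cast
  ring

theorem integral_numTriangles {Ω : Type*} [MeasurableSpace Ω]
    {P : Measure Ω} [IsProbabilityMeasure P] {n m : ℕ} {B : Fin n → Fin m → Ω → ℕ} {p : ℝ}
    (hB : IsBinomialAttributeMatrix P B p) :
    6 * ∫ ω, (numTriangles (randomIntersectionGraph B ω) : ℝ) ∂P =
      ∑ t ∈ distinctTriples Finset.univ, P.real (triangleEvent B t) := by
  rw [← integral_orderedTriangles hB, ← integral_const_mul]
  refine integral_congr_ae (ae_of_all _ fun ω => ?_)
  simp only [← six_mul_numTriangles]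
  push_cast
  ring

theorem modelTransitivity_eq {Ω : Type*} [MeasurableSpace Ω]
    {P : Measure Ω} [IsProbabilityMeasure P] {n m : ℕ} {B : Fin n → Fin m → Ω → ℕ} {p : ℝ}
    (hB : IsBinomialAttributeMatrix P B p) :
    modelTransitivity P (randomIntersectionGraph B) =
      (∑ t ∈ distinctTriples Finset.univ, P.real (triangleEvent B t)) /
        ∑ t ∈ distinctTriples Finset.univ, P.real (starEvent B t) := by
  rw [← integral_numTwoStars hB, ← integral_numTriangles hB, modelTransitivity, ← mul_div_assoc,
    show (6 : ℝ) = 2 * 3 by norm_num, mul_assoc, mul_div_mul_left _ _ two_ne_zero]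

/-- The model transitivity coefficient converges to `1 / (1 + mu)`. -/
theorem eventually_modelTransitivity (h : IsBalancedSparse lam mu n m p) (hlam : 0 < lam)
    (hmu : 0 < mu) (hB : ∀ ν, IsBinomialAttributeMatrix (P ν) (B ν) (p ν)) {ε : ℝ}
    (hε : 0 < ε) :
    ∀ᶠ ν in atTop, 0 < ∫ ω, (numTwoStars (randomIntersectionGraph (B ν) ω) : ℝ) ∂(P ν) ∧
      |modelTransitivity (P ν) (randomIntersectionGraph (B ν)) - 1 / (1 + mu)| ≤ ε := by
  have hcS : 0 < lam ^ 2 / mu + lam ^ 2 := by positivity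
  obtain ⟨δ, hδ, hdiv⟩ := exists_pos_forall_abs_div_sub_le (b := lam ^ 2 / mu) hcS hε
  filter_upwards [eventually_abs_sum_starEvent_sub_le h hlam hmu hB h.tendsto_n (half_pos hδ),
    eventually_abs_sum_triangleEvent_sub_le h hlam hmu hB h.tendsto_n (half_pos hδ),
    h.tendsto_cast.eventually_gt_atTop 0] with ν h1 h2 h3
  have hr : 0 < (n ν : ℝ) ^ 3 / (n ν : ℝ) ^ 2 := by positivity
  have hlt : δ / 2 * ((n ν : ℝ) ^ 3 / (n ν : ℝ) ^ 2) < δ * ((n ν : ℝ) ^ 3 / (n ν : ℝ) ^ 2) :=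
    mul_lt_mul_of_pos_right (half_lt_self hδ) hr
  obtain ⟨k1, k2⟩ := hdiv _ _ _ hr
    ((h1 Finset.univ (Finset.card_fin _)).trans_lt hlt)
    ((h2 Finset.univ (Finset.card_fin _)).trans_lt hlt)
  rw [limit_ratio hlam hmu, ← modelTransitivity_eq (hB ν)] at k2
  rw [← integral_numTwoStars (hB ν)] at k1
  exact ⟨pos_of_mul_pos_right k1 zero_le_two, k2⟩

end Transitivity

theorem theorem2 {Ω : ℕ → Type*} [∀ ν, MeasurableSpace (Ω ν)]
    (P : ∀ ν, Measure (Ω ν)) [∀ ν, IsProbabilityMeasure (P ν)]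
    (lam mu : ℝ) (hlam : 0 < lam) (hmu : 0 < mu)
    (n m : ℕ → ℕ) (p : ℕ → ℝ) (hreg : IsBalancedSparse lam mu n m p)
    (B : ∀ ν, Fin (n ν) → Fin (m ν) → Ω ν → ℕ)
    (hB : ∀ ν, IsBinomialAttributeMatrix (P ν) (B ν) (p ν)) :
    -- the observed subgraph, induced by `n₀ ≫ n ^ (2 / 3)` nodes chosen independently of `G`
    (∀ (n₀ : ℕ → ℕ) (S : ∀ ν, Ω ν → Finset (Fin (n ν))),
      (∀ ν, Measurable (S ν)) →
      (∀ ν ω, (S ν ω).card = n₀ ν) →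
      (∀ ν, IndepFun (S ν) (randomIntersectionGraph (B ν)) (P ν)) →
      ((fun ν => (n ν : ℝ) ^ (2 / 3 : ℝ)) =o[atTop] fun ν => (n₀ ν : ℝ)) →
      Tendsto (fun ν => P ν {ω | 0 < numTwoStars
        ((randomIntersectionGraph (B ν) ω).induce (S ν ω : Set (Fin (n ν))))}) atTop (𝓝 1) ∧
      IsLittleOpOne P (fun ν ω => transitivity
        ((randomIntersectionGraph (B ν) ω).induce (S ν ω : Set (Fin (n ν)))) - 1 / (1 + mu))) ∧
    -- the whole graph
    (∀ᶠ ν in atTop, 0 < ∫ ω, (numTwoStars (randomIntersectionGraph (B ν) ω) : ℝ) ∂(P ν)) ∧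
    IsLittleOpOne P (fun ν ω => transitivity (randomIntersectionGraph (B ν) ω) -
      modelTransitivity (P ν) (randomIntersectionGraph (B ν))) := by
  refine ⟨fun n₀ S hS hcard hind ho => ⟨?_, fun ε hε => ?_⟩, ?_, fun ε hε => ?_⟩
  -- Typical graphs have a 2-star for every tolerance, so 1 is an arbitrary choice. The union bound
  -- gives the lower bound `1 - P(atypical)`.
  · have hlim := (ENNReal.Tendsto.sub tendsto_const_nhds
      (tendsto_measure_atypical hreg hlam hmu hB hS hcard hind ho one_pos)
      (Or.inl ENNReal.one_ne_top) : Tendsto (fun ν => (1 : ENNReal) - _) atTop (𝓝 (1 - 0)))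
    rw [tsub_zero] at hlim
    refine tendsto_of_tendsto_of_tendsto_of_le_of_le hlim tendsto_const_nhds (fun ν => ?_)
      fun ν => prob_le_one
    refine tsub_le_iff_right.2 ?_
    rw [← measure_univ (μ := P ν)]
    refine (measure_mono fun ω _ => ?_).trans (measure_union_le _ _)
    by_cases hω : randomIntersectionGraph (B ν) ω ∈ atypical mu 1 (S ν ω)
    · exact Or.inr hω
    · refine Or.inl ?_
      have hpos := (not_not.1 hω).1
      rw [← two_mul_numTwoStars_induce] at hpos
      exact pos_of_mul_pos_right hpos (Nat.zero_le 2)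
  · refine tendsto_of_tendsto_of_tendsto_of_le_of_le tendsto_const_nhds
      (tendsto_measure_atypical hreg hlam hmu hB hS hcard hind ho hε) (fun ν => zero_le)
      fun ν => measure_mono fun ω hω hgood => ?_
    refine not_lt.2 hgood.2 ?_
    rw [← transitivity_induce]
    exact hω
  · exact (eventually_modelTransitivity hreg hlam hmu hB one_pos).mono fun ν hν => hν.1
  · have ho : (fun ν => (n ν : ℝ) ^ (2 / 3 : ℝ)) =o[atTop] fun ν => (n ν : ℝ) := by
      have hdiv : Tendsto (fun x : ℝ => x ^ (2 / 3 : ℝ) / x) atTop (𝓝 0) := by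
        refine (tendsto_rpow_neg_atTop (show (0 : ℝ) < 1 / 3 by norm_num)).congr' ?_
        filter_upwards [eventually_gt_atTop 0] with x hx
        rw [← Real.rpow_sub_one hx.ne']
        norm_num
      refine (isLittleO_of_tendsto' ?_ (hdiv.comp hreg.tendsto_cast))
      filter_upwards [hreg.tendsto_cast.eventually_gt_atTop 0] with ν hν h0
      exact absurd h0 hν.ne'
    -- The whole graph is the case of the constant node set, which is independent of everything.
    -- Half of `ε` is kept for the distance of the model coefficient from `1 / (1 + mu)`.
    have hlim := tendsto_measure_atypical hreg hlam hmu hB (n₀ := n) (S := fun _ _ => Finset.univ)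
      (fun _ => measurable_const) (fun _ _ => Finset.card_fin _)
      (fun ν => indepFun_const_left _ _) ho (half_pos hε)
    refine tendsto_of_tendsto_of_tendsto_of_le_of_le' tendsto_const_nhds hlim
      (Eventually.of_forall fun ν => zero_le) ?_
    filter_upwards [eventually_modelTransitivity hreg hlam hmu hB (half_pos hε)] with ν hν
    refine measure_mono fun ω hω hgood => ?_
    have h1 := hgood.2
    rw [← transitivity_eq] at h1
    have h2 := abs_sub_le (transitivity (randomIntersectionGraph (B ν) ω)) (1 / (1 + mu))
      (modelTransitivity (P ν) (randomIntersectionGraph (B ν)))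
    have h3 := hν.2
    rw [abs_sub_comm] at h3
    have h4 : ε < |transitivity (randomIntersectionGraph (B ν) ω) -
      modelTransitivity (P ν) (randomIntersectionGraph (B ν))| := hω
    linarith
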